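/- Let $(E,\|\cdot\|_E)$ be a real Banach space of Rademacher type $p\in[1,2]$, let $q\in[p,\infty)$ and $k,M\in\mathbb{N}=\{1,2,\dots\}$, and let $\xi_1,\dots,\xi_M\in L_{kq}(\Omega;E)$ be independent and identically distributed $E$-valued (strongly measurable) random variables on a probability space $(\Omega,\mathcal{A},\mathbb{P})$. Write $\otimes^k x = x\otimes\cdots\otimes x$ ($k$ factors). The $k$-fold injective tensor product $\otimes^k_\varepsilon E$ is the completion of the algebraic tensor product $\otimes^k E$ with respect to $\|U\|_\varepsilon=\sup\{|\langle f_1\otimes\cdots\otimes f_k,U\rangle| : f_1,\dots,f_k\in E',\ \|f_n\|_{E'}\le 1\}$. The $k$-fold symmetric injective tensor product $\otimes^{k,s}_{\varepsilon_s}E$ is the completion of the space $\otimes^{k,s}E\subseteq\otimes^kE$ of symmetric tensors (the linear span of the symmetrizations $\frac1{k!}\sum_{\sigma\in S_k}x_{\sigma(1)}\otimes\cdots\otimes x_{\sigma(k)}$) with respect to $\bigl\|\sum_j\lambda_j\otimes^k x_j\bigr\|_{\varepsilon_s}=\sup\bigl\{\bigl|\sum_j\lambda_j f(x_j)^k\bigr|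 : f\in E',\ \|f\|_{E'}\le1\bigr\}$. The closure of $\otimes^{k,s}E$ in $\otimes^k_\varepsilon E$ is identified with $\otimes^{k,s}_{\varepsilon_s}E$ through the continuous extension $\otimes^k_\varepsilon E\to\otimes^{k,s}_{\varepsilon_s}E$ of the symmetrization. Then the injective $k$-th moment $\mathbb{M}^k_\varepsilon[\xi_1]:=\mathbb{E}[\otimes^k\xi_1]$ exists as a Bochner integral in $\otimes^k_\varepsilon E$ and belongs to (the closure of) the symmetric tensors, the error $\mathbb{M}^k_\varepsilon[\xi_1]-\frac1M\sum_{j=1}^M\otimes^k\xi_j$ belongs to $L_q(\Omega;\otimes^{k,s}_{\varepsilon_s}E)$, and $$\Bigl\|\mathbb{M}^k_\varepsilon[\xi_1]-\frac1M\sum_{j=1}^M\otimes^k\xi_j\Bigr\|_{L_q(\Omega;\otimes^{k,s}_{\varepsilon_s}E)}\le 2\bigl(2k\,K_{q,p}\,\tau_p(E)+B_q\bigr)\,M^{-(1-\frac1p)}\,\|\xi_1\|_{L_{kq}(\Omega;E)}^k .$$ Here, for any Rademacher family $(r_j)_{j\in\mathbb{N}}$ (independent, $\pm1$ with probability $\frac12$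 each) on any complete probability space $\widetilde\Omega$: $E$ is of Rademacher type $p$ if there is $\tau\in(0,\infty)$ with $\|\sum_{j=1}^n r_jx_j\|_{L_p(\widetilde\Omega;E)}\le\tau(\sum_{j=1}^n\|x_j\|_E^p)^{1/p}$ for all $n$ and $x_1,\dots,x_n\in E$, and $\tau_p(E)$ is the infimum of all such $\tau$; $K_{q,p}$ is the smallest $K\in(0,\infty)$ with $\|\sum_{j=1}^n r_jx_j\|_{L_q(\widetilde\Omega;F)}\le K\|\sum_{j=1}^n r_jx_j\|_{L_p(\widetilde\Omega;F)}$ for all real Banach spaces $F$, all $n$ and $x_1,\dots,x_n\in F$; and $B_q$ is the smallest $B\in(0,\infty)$ with $\|\sum_{j=1}^n r_ja_j\|_{L_q(\widetilde\Omega;\mathbb{R})}\le B(\sum_{j=1}^n a_j^2)^{1/2}$ for all $n$ and $a_1,\dots,a_n\in\mathbb{R}$. -/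

import Mathlib

open MeasureTheory ProbabilityTheory
open scoped TensorProduct ENNReal Nat

universe u v w

noncomputable section

namespace MonteCarloMoments

/-! ### Rademacher families and the constants attached to them -/

/-- `r` is a Rademacher family on `(Ω, P)`: independent random variables with values in `{-1, 1}`,
each value being attained with probability `1/2`. -/
structure IsRademacherFamily {Ω : Type w} [MeasurableSpace Ω] (r : ℕ → Ω → ℝ) (P : Measure Ω) :
    Prop where
  measurable : ∀ j, Measurable (r j)
  range : ∀ j ω, r j ω = -1 ∨ r j ω = 1
  prob_neg_one : ∀ j, P {ω | r j ω = -1} = 1 / 2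
  prob_one : ∀ j, P {ω | r j ω = 1} = 1 / 2
  indep : iIndepFun r P

/-- `K ∈ (0,∞)` is admissible in the Kahane–Khintchine inequality
`‖∑ r_j x_j‖_{L_q} ≤ K ‖∑ r_j x_j‖_{L_p}` for all Rademacher families on complete probability
spaces and all finite families of vectors in an arbitrary real Banach space. -/
def IsKahaneKhintchineBound (q p K : ℝ) : Prop :=
  0 < K ∧
  ∀ (Ω : Type w) [MeasurableSpace Ω] (P : Measure Ω) [IsProbabilityMeasure P] [P.IsComplete]
    (r : ℕ → Ω → ℝ), IsRademacherFamily r P →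
  ∀ (F : Type u) [NormedAddCommGroup F] [NormedSpace ℝ F] [CompleteSpace F]
    (n : ℕ) (x : Fin n → F),
    eLpNorm (fun ω => ∑ j : Fin n, r j ω • x j) (ENNReal.ofReal q) P ≤
      ENNReal.ofReal K * eLpNorm (fun ω => ∑ j : Fin n, r j ω • x j) (ENNReal.ofReal p) P

/-- The Kahane–Khintchine constant `K_{q,p}`: the smallest admissible constant. -/
def kahaneKhintchineConst (q p : ℝ) : ℝ := sInf {K : ℝ | IsKahaneKhintchineBound.{u, w} q p K}

/-- `τ ∈ (0,∞)` is admissible in the type `p` inequality of the Banach space `F`. -/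
def IsTypeBound (F : Type u) [NormedAddCommGroup F] [NormedSpace ℝ F] (p τ : ℝ) : Prop :=
  0 < τ ∧
  ∀ (Ω : Type w) [MeasurableSpace Ω] (P : Measure Ω) [IsProbabilityMeasure P] [P.IsComplete]
    (r : ℕ → Ω → ℝ), IsRademacherFamily r P →
  ∀ (n : ℕ) (x : Fin n → F),
    eLpNorm (fun ω => ∑ j : Fin n, r j ω • x j) (ENNReal.ofReal p) P ≤
      ENNReal.ofReal (τ * (∑ j : Fin n, ‖x j‖ ^ p) ^ (1 / p))

/-- `F` is of (Rademacher) type `p`. -/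
def HasRademacherType (F : Type u) [NormedAddCommGroup F] [NormedSpace ℝ F] (p : ℝ) : Prop :=
  ∃ τ : ℝ, IsTypeBound.{u, w} F p τ

/-- The type `p` constant `τ_p(F)`: the smallest admissible constant. -/
def typeConst (F : Type u) [NormedAddCommGroup F] [NormedSpace ℝ F] (p : ℝ) : ℝ :=
  sInf {τ : ℝ | IsTypeBound.{u, w} F p τ}

/-- `B ∈ (0,∞)` is admissible in the upper classical (real) Khintchine inequality
`‖∑ r_j a_j‖_{L_q} ≤ B (∑ a_j²)^{1/2}`. -/
def IsKhintchineUpperBound (q B : ℝ) : Prop :=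
  0 < B ∧
  ∀ (Ω : Type w) [MeasurableSpace Ω] (P : Measure Ω) [IsProbabilityMeasure P] [P.IsComplete]
    (r : ℕ → Ω → ℝ), IsRademacherFamily r P →
  ∀ (n : ℕ) (a : Fin n → ℝ),
    eLpNorm (fun ω => ∑ j : Fin n, r j ω * a j) (ENNReal.ofReal q) P ≤
      ENNReal.ofReal (B * Real.sqrt (∑ j : Fin n, a j ^ 2))

/-- The constant `B_q` of the classical Khintchine inequality: the smallest admissible one. -/
def khintchineConst (q : ℝ) : ℝ := sInf {B : ℝ | IsKhintchineUpperBound.{w} q B}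

/-! ### Injective tensor products

Mathlib's `PiTensorProduct` carries a norm instance of its own, which is not the injective tensor
norm; the algebraic tensor products are therefore wrapped in new type names. -/

section Tensor

variable (k : ℕ) (E : Type u) [NormedAddCommGroup E] [NormedSpace ℝ E]

variable {k E} in
/-- The linear functional `f_1 ⊗ ⋯ ⊗ f_k` on the `k`-fold algebraic tensor product. -/
def dualTensor (f : Fin k → StrongDual ℝ E) : (⨂[ℝ] _ : Fin k, E) →ₗ[ℝ] ℝ :=
  PiTensorProduct.lift
    ((MultilinearMap.mkPiAlgebra ℝ (Fin k) ℝ).compLinearMap fun i => (f i : E →ₗ[ℝ] ℝ))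

variable {k E} in
theorem dualTensor_tprod (f : Fin k → StrongDual ℝ E) (x : Fin k → E) :
    dualTensor f (PiTensorProduct.tprod ℝ x) = ∏ i, f i (x i) := by
  simp [dualTensor]

variable {k E} in
theorem dualTensor_bdd (U : ⨂[ℝ] _ : Fin k, E) :
    ∃ C : ℝ, ∀ f : Fin k → StrongDual ℝ E, (∀ i, ‖f i‖ ≤ 1) → |dualTensor f U| ≤ C := by
  induction U using PiTensorProduct.induction_on with
  | smul_tprod c x =>
    refine ⟨|c| * ∏ i, ‖x i‖, fun f hf => ?_⟩
    rw [map_smul, dualTensor_tprod, smul_eq_mul, abs_mul, Finset.abs_prod]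
    gcongr with i
    simpa using (f i).le_of_opNorm_le (hf i) (x i)
  | add U V hU hV =>
    obtain ⟨C, hC⟩ := hU
    obtain ⟨D, hD⟩ := hV
    refine ⟨C + D, fun f hf => ?_⟩
    rw [map_add]
    exact (abs_add_le _ _).trans (add_le_add (hC f hf) (hD f hf))

/-- The `k`-fold algebraic tensor product of `E`, to be normed by the injective tensor norm. -/
def AlgTensor : Type u := ⨂[ℝ] _ : Fin k, E

instance : AddCommGroup (AlgTensor k E) := inferInstanceAs (AddCommGroup (⨂[ℝ] _ : Fin k, E))

instance : Module ℝ (AlgTensor k E) := inferInstanceAs (Module ℝ (⨂[ℝ] _ : Fin k, E))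

/-- The injective tensor norm `‖U‖_ε = sup {|⟨f_1 ⊗ ⋯ ⊗ f_k, U⟩| : f_1, …, f_k ∈ B_{E'}}`. -/
instance : Norm (AlgTensor k E) where
  norm U := ⨆ f : {f : Fin k → StrongDual ℝ E // ∀ i, ‖f i‖ ≤ 1}, |dualTensor f.1 U|

variable {k E} in
theorem AlgTensor.le_norm (U : AlgTensor k E) (f : Fin k → StrongDual ℝ E)
    (hf : ∀ i, ‖f i‖ ≤ 1) : |dualTensor f U| ≤ ‖U‖ := by
  obtain ⟨C, hC⟩ := dualTensor_bdd (k := k) (E := E) U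
  exact le_ciSup (f := fun f : {f : Fin k → StrongDual ℝ E // ∀ i, ‖f i‖ ≤ 1} =>
    |dualTensor f.1 U|) ⟨C, by rintro _ ⟨g, rfl⟩; exact hC g.1 g.2⟩ ⟨f, hf⟩

variable {k E} in
theorem AlgTensor.norm_le (U : AlgTensor k E) (C : ℝ)
    (h : ∀ f : Fin k → StrongDual ℝ E, (∀ i, ‖f i‖ ≤ 1) → |dualTensor f U| ≤ C) : ‖U‖ ≤ C := by
  have : Nonempty {f : Fin k → StrongDual ℝ E // ∀ i, ‖f i‖ ≤ 1} := ⟨⟨0, by simp⟩⟩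
  exact ciSup_le fun f => h f.1 f.2

theorem AlgTensor.core : SeminormedSpace.Core ℝ (AlgTensor k E) where
  norm_nonneg U := Real.iSup_nonneg fun _ => abs_nonneg _
  norm_smul c U := by
    change (⨆ f : {f : Fin k → StrongDual ℝ E // ∀ i, ‖f i‖ ≤ 1},
      |dualTensor f.1 (c • (U : ⨂[ℝ] _ : Fin k, E))|) = ‖c‖ * ⨆ f, _
    rw [Real.mul_iSup_of_nonneg (norm_nonneg c)]
    refine iSup_congr fun f => ?_
    exact (congrArg _ ((dualTensor f.1).map_smul c U)).trans (abs_mul _ _)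
  norm_triangle U V := by
    refine AlgTensor.norm_le _ _ fun f hf => ?_
    refine le_trans (le_of_eq_of_le ?_ (abs_add_le (dualTensor f U) (dualTensor f V)))
      (add_le_add (U.le_norm f hf) (V.le_norm f hf))
    exact congrArg _ (map_add (dualTensor f) _ _)

instance : SeminormedAddCommGroup (AlgTensor k E) :=
  SeminormedAddCommGroup.ofCore (AlgTensor.core k E)

instance : NormedSpace ℝ (AlgTensor k E) where
  norm_smul_le c U := ((AlgTensor.core k E).norm_smul c U).le

/-- The `k`-fold injective tensor product `⊗^k_ε E`: the completion of the algebraic one. -/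
abbrev InjTensor : Type u := UniformSpace.Completion (AlgTensor k E)

variable {E} in
/-- The tensor power `⊗^k x = x ⊗ ⋯ ⊗ x` in the algebraic tensor product. -/
def AlgTensor.pow (x : E) : AlgTensor k E := PiTensorProduct.tprod ℝ (fun _ : Fin k => x)

variable {E} in
/-- The tensor power `⊗^k x = x ⊗ ⋯ ⊗ x` as an element of `⊗^k_ε E`. -/
def tensorPow (x : E) : InjTensor k E := (AlgTensor.pow k x : InjTensor k E)

/-- The symmetrization operator on the `k`-fold algebraic tensor product,
see `symmetrize_tprod`. -/
def symmetrize : (⨂[ℝ] _ : Fin k, E) →ₗ[ℝ] (⨂[ℝ] _ : Fin k, E) :=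
  ((k ! : ℝ)⁻¹) • ∑ σ : Equiv.Perm (Fin k),
    ((PiTensorProduct.reindex ℝ (fun _ : Fin k => E) σ.symm).toLinearMap :
      (⨂[ℝ] _ : Fin k, E) →ₗ[ℝ] (⨂[ℝ] _ : Fin k, E))

variable {k E} in
theorem symmetrize_tprod (x : Fin k → E) :
    symmetrize k E (PiTensorProduct.tprod ℝ x) =
      ((k ! : ℝ)⁻¹) • ∑ σ : Equiv.Perm (Fin k), PiTensorProduct.tprod ℝ (fun i => x (σ i)) := by
  simp [symmetrize, LinearMap.sum_apply]

/-- The `k`-fold symmetric algebraic tensor product, as a subspace of the full one: the linear span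
of the symmetrizations of elementary tensors. -/
def symSubmodule : Submodule ℝ (⨂[ℝ] _ : Fin k, E) :=
  Submodule.span ℝ (Set.range fun x : Fin k → E => symmetrize k E (PiTensorProduct.tprod ℝ x))

variable {E} in
theorem tprod_const_mem (x : E) :
    PiTensorProduct.tprod ℝ (fun _ : Fin k => x) ∈ symSubmodule k E := by
  have h : symmetrize k E (PiTensorProduct.tprod ℝ (fun _ : Fin k => x)) =
      PiTensorProduct.tprod ℝ (fun _ : Fin k => x) := by
    rw [symmetrize_tprod, Finset.sum_const, Finset.card_univ, Fintype.card_perm, Fintype.card_fin,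
      ← Nat.cast_smul_eq_nsmul ℝ, smul_smul, inv_mul_cancel₀ (by positivity), one_smul]
  rw [← h]
  exact Submodule.subset_span ⟨_, rfl⟩

theorem symmetrize_mem (U : ⨂[ℝ] _ : Fin k, E) : symmetrize k E U ∈ symSubmodule k E := by
  induction U using PiTensorProduct.induction_on with
  | smul_tprod c x =>
    rw [map_smul]
    exact Submodule.smul_mem _ _ (Submodule.subset_span ⟨x, rfl⟩)
  | add U V hU hV =>
    rw [map_add]
    exact Submodule.add_mem _ hU hV

variable {k E} in
theorem dualTensor_const_symmetrize (f : StrongDual ℝ E) (U : ⨂[ℝ] _ : Fin k, E) :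
    dualTensor (fun _ => f) (symmetrize k E U) = dualTensor (fun _ => f) U := by
  induction U using PiTensorProduct.induction_on with
  | smul_tprod c x =>
    have h : ∀ σ : Equiv.Perm (Fin k), ∏ i, f (x (σ i)) = ∏ i, f (x i) :=
      fun σ => Equiv.prod_comp σ fun i => f (x i)
    simp only [map_smul, symmetrize_tprod, map_sum, dualTensor_tprod, h, Finset.sum_const,
      Finset.card_univ, Fintype.card_perm, Fintype.card_fin]
    rw [← Nat.cast_smul_eq_nsmul ℝ, smul_smul ((k ! : ℝ)⁻¹), inv_mul_cancel₀ (by positivity),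
      one_smul]
  | add U V hU hV => rw [map_add, map_add, map_add, hU, hV]

/-- The `k`-fold symmetric algebraic tensor product of `E`, to be normed by the symmetric injective
tensor norm. -/
def SymAlgTensor : Type u := symSubmodule k E

instance : AddCommGroup (SymAlgTensor k E) := inferInstanceAs (AddCommGroup (symSubmodule k E))

instance : Module ℝ (SymAlgTensor k E) := inferInstanceAs (Module ℝ (symSubmodule k E))

/-- The inclusion of the symmetric into the full algebraic tensor product. -/
def symIncl : SymAlgTensor k E →ₗ[ℝ] AlgTensor k E := (symSubmodule k E).subtype

/-- The symmetric injective tensor norm `‖U‖_{ε_s} = sup {|⟨f ⊗ ⋯ ⊗ f, U⟩| : f ∈ B_{E'}}`;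
here `⟨f ⊗ ⋯ ⊗ f, U⟩ = ∑ λ_j f(x_j)^k` if `U = ∑ λ_j ⊗^k x_j`, see `dualTensor_tprod`. -/
instance : Norm (SymAlgTensor k E) where
  norm U := ⨆ f : {f : StrongDual ℝ E // ‖f‖ ≤ 1}, |dualTensor (fun _ => f.1) (symIncl k E U)|

variable {k E} in
theorem SymAlgTensor.le_norm (U : SymAlgTensor k E) (f : StrongDual ℝ E) (hf : ‖f‖ ≤ 1) :
    |dualTensor (fun _ => f) (symIncl k E U)| ≤ ‖U‖ := by
  obtain ⟨C, hC⟩ := dualTensor_bdd (k := k) (E := E) (symIncl k E U)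
  exact le_ciSup (f := fun f : {f : StrongDual ℝ E // ‖f‖ ≤ 1} =>
    |dualTensor (fun _ => f.1) (symIncl k E U)|)
    ⟨C, by rintro _ ⟨g, rfl⟩; exact hC _ fun _ => g.2⟩ ⟨f, hf⟩

variable {k E} in
theorem SymAlgTensor.norm_le (U : SymAlgTensor k E) (C : ℝ)
    (h : ∀ f : StrongDual ℝ E, ‖f‖ ≤ 1 → |dualTensor (fun _ => f) (symIncl k E U)| ≤ C) :
    ‖U‖ ≤ C := by
  have : Nonempty {f : StrongDual ℝ E // ‖f‖ ≤ 1} := ⟨⟨0, by simp⟩⟩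
  exact ciSup_le fun f => h f.1 f.2

theorem SymAlgTensor.core : SeminormedSpace.Core ℝ (SymAlgTensor k E) where
  norm_nonneg U := Real.iSup_nonneg fun _ => abs_nonneg _
  norm_smul c U := by
    change (⨆ f : {f : StrongDual ℝ E // ‖f‖ ≤ 1},
      |dualTensor (fun _ => f.1) (c • (symIncl k E U : ⨂[ℝ] _ : Fin k, E))|) = ‖c‖ * ⨆ f, _
    rw [Real.mul_iSup_of_nonneg (norm_nonneg c)]
    refine iSup_congr fun f => ?_
    exact (congrArg _ ((dualTensor fun _ => f.1).map_smul c (symIncl k E U))).trans (abs_mul _ _)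
  norm_triangle U V := by
    refine SymAlgTensor.norm_le _ _ fun f hf => ?_
    refine le_trans (le_of_eq_of_le ?_ (abs_add_le (dualTensor (fun _ => f) (symIncl k E U))
      (dualTensor (fun _ => f) (symIncl k E V))))
      (add_le_add (U.le_norm f hf) (V.le_norm f hf))
    exact congrArg _ (map_add (dualTensor fun _ => f) _ _)

instance : SeminormedAddCommGroup (SymAlgTensor k E) :=
  SeminormedAddCommGroup.ofCore (SymAlgTensor.core k E)

instance : NormedSpace ℝ (SymAlgTensor k E) where
  norm_smul_le c U := ((SymAlgTensor.core k E).norm_smul c U).le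

/-- The `k`-fold symmetric injective tensor product `⊗^{k,s}_{ε_s} E`: the completion of the
symmetric algebraic one. -/
abbrev SymInjTensor : Type u := UniformSpace.Completion (SymAlgTensor k E)

variable {E} in
/-- The tensor power `⊗^k x = x ⊗ ⋯ ⊗ x` in the symmetric algebraic tensor product. -/
def SymAlgTensor.pow (x : E) : SymAlgTensor k E :=
  (⟨PiTensorProduct.tprod ℝ (fun _ : Fin k => x), tprod_const_mem k x⟩ : symSubmodule k E)

variable {E} in
/-- The tensor power `⊗^k x = x ⊗ ⋯ ⊗ x` as an element of `⊗^{k,s}_{ε_s} E`. -/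
def symTensorPow (x : E) : SymInjTensor k E := (SymAlgTensor.pow k x : SymInjTensor k E)

/-- The symmetrization as a linear map onto the symmetric algebraic tensor product. -/
def symProjAlgₗ : AlgTensor k E →ₗ[ℝ] SymAlgTensor k E :=
  (symmetrize k E).codRestrict (symSubmodule k E) (symmetrize_mem k E)

/-- The symmetrization is a contraction for the norms `‖·‖_ε` and `‖·‖_{ε_s}`. -/
theorem norm_symProjAlgₗ_le (U : AlgTensor k E) : ‖symProjAlgₗ k E U‖ ≤ 1 * ‖U‖ := by
  rw [one_mul]
  refine SymAlgTensor.norm_le _ _ fun f hf => ?_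
  refine le_of_eq_of_le (congrArg _ ?_) (U.le_norm (fun _ => f) fun _ => hf)
  exact dualTensor_const_symmetrize f U

/-- The continuous extension `s_ε : ⊗^k_ε E → ⊗^{k,s}_{ε_s} E` of the symmetrization; on (limits of)
symmetric tensors it is the identification of the symmetric part of `⊗^k_ε E` with
`⊗^{k,s}_{ε_s} E`. -/
def symProj : InjTensor k E →L[ℝ] SymInjTensor k E :=
  ((symProjAlgₗ k E).mkContinuous 1 (norm_symProjAlgₗ_le k E)).completion

/-- The closed subspace of symmetric elements of `⊗^k_ε E`: the closure of the symmetric algebraic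
tensors. -/
def symPart : Set (InjTensor k E) :=
  closure (Set.range fun U : SymAlgTensor k E => (symIncl k E U : InjTensor k E))

variable {E} in
/-- The injective `k`-th moment `M^k_ε[ξ] = 𝔼[⊗^k ξ]`, a Bochner integral in `⊗^k_ε E`. -/
def injMoment {Ω : Type v} [MeasurableSpace Ω] (ξ : Ω → E) (P : Measure Ω) : InjTensor k E :=
  ∫ ω, tensorPow k (ξ ω) ∂P

end Tensor

end MonteCarloMoments

end

open MonteCarloMoments

/-! The error is `M⁻¹` times a sum of centred i.i.d. copies of `⊗^k ξ`, so the rate can be read off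
from Rademacher sums. Symmetrization (`lintegral_symmetrization`) bounds the `L_q` norm of the
centred sum by twice that of `∑ r_j ⊗^k ξ_j`.

Type `p` is assumed of `E`, not of the tensor product, so these sums must be brought back to `E`. In
the symmetric injective norm, a sum of tensor powers is a supremum over the dual ball of `|∑ r_j
f(x_j)^k|`. On `[-‖x_j‖, ‖x_j‖]` the map `t ↦ t^k` vanishes at `0` and has Lipschitz constant `k
‖x_j‖^(k-1)`. Talagrand's contraction principle (`signAvg_iSup_abs_rpow_le`) therefore replaces
`f(x_j)^k` by the linear expression `k ‖x_j‖^(k-1) f(x_j)` at the cost of a factor `2`. The supremum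
is then `k` times the norm in `E` of `∑ r_j ‖x_j‖^(k-1) x_j` (`signAvg_symTensorPow_le`).

Kahane–Khintchine and type `p` bound its `L_q` norm by `K_{q,p} τ_p(E) (∑ ‖x_j‖^(kp))^(1/p)`. The
power mean inequality and integration give `M^(1/p) ‖ξ‖^k`; dividing by `M` gives the rate. The term
`B_q` is nonnegative and only enlarges the bound obtained this way.

Finite Rademacher sums are treated as averages over the cube `{-1,1}^n`
(`IsRademacherFamily.lintegral_eq`). Since the constants are infima, the argument also shows that an
admissible `K` exists (`exists_isKahaneKhintchineBound`, from a hypercontractive estimate) and that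
Rademacher families exist (`exists_isRademacherFamily`). -/

namespace MonteCarloMoments

/-! ### Averages over the discrete cube -/

/-- The sign encoded by a Boolean. -/
noncomputable def signOf (b : Bool) : ℝ := if b then 1 else -1

/-- The average of `η` over the discrete cube `{-1, 1}^n`. -/
noncomputable def signAvg (n : ℕ) (η : (Fin n → ℝ) → ℝ) : ℝ :=
  (2 ^ n)⁻¹ * ∑ ε : Fin n → Bool, η fun j => signOf (ε j)

theorem signAvg_zero (η : (Fin 0 → ℝ) → ℝ) : signAvg 0 η = η ![] := by
  simp only [signAvg, pow_zero, inv_one, one_mul, Finset.univ_unique, Finset.sum_singleton]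
  congr 1
  exact Subsingleton.elim _ _

/-- Conditioning on the first sign; this drives the inductions on `n`. -/
theorem signAvg_succ {n : ℕ} (η : (Fin (n + 1) → ℝ) → ℝ) :
    signAvg (n + 1) η =
      (signAvg n (fun e => η (Fin.cons 1 e)) + signAvg n (fun e => η (Fin.cons (-1) e))) / 2 := by
  have h : ∀ (b : Bool) (ε : Fin n → Bool),
      (fun j => signOf ((Fin.cons b ε : Fin (n + 1) → Bool) j)) =
        Fin.cons (signOf b) (fun j => signOf (ε j)) := by
    intro b ε
    funext j
    refine Fin.cases ?_ (fun i => ?_) j <;> simp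
  simp only [signAvg]
  rw [← (Fin.consEquiv fun _ : Fin (n + 1) => Bool).sum_comp, Fintype.sum_prod_type,
    Fintype.sum_bool]
  simp only [Fin.consEquiv, Equiv.coe_fn_mk, h]
  simp only [signOf, if_true, Bool.false_eq_true, if_false, pow_succ, mul_inv]
  ring

theorem signAvg_mono {n : ℕ} {η θ : (Fin n → ℝ) → ℝ} (h : ∀ e, η e ≤ θ e) :
    signAvg n η ≤ signAvg n θ := by
  unfold signAvg
  gcongr
  exact h _

theorem signAvg_nonneg {n : ℕ} {η : (Fin n → ℝ) → ℝ} (h : ∀ e, 0 ≤ η e) : 0 ≤ signAvg n η :=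
  mul_nonneg (by positivity) (Finset.sum_nonneg fun _ _ => h _)

theorem signAvg_add {n : ℕ} (η θ : (Fin n → ℝ) → ℝ) :
    signAvg n (fun e => η e + θ e) = signAvg n η + signAvg n θ := by
  simp only [signAvg, Finset.sum_add_distrib, mul_add]

theorem signAvg_const_mul {n : ℕ} (c : ℝ) (η : (Fin n → ℝ) → ℝ) :
    signAvg n (fun e => c * η e) = c * signAvg n η := by
  simp only [signAvg, ← Finset.mul_sum]
  ring

theorem signAvg_comp_neg {n : ℕ} (η : (Fin n → ℝ) → ℝ) :
    signAvg n (fun e => η (-e)) = signAvg n η := by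
  induction n with
  | zero => simp only [signAvg_zero]; congr 1; exact Subsingleton.elim _ _
  | succ n ih =>
    have h : ∀ (c : ℝ) (e : Fin n → ℝ), -(Fin.cons c e : Fin (n + 1) → ℝ) = Fin.cons (-c) (-e) := by
      intro c e
      funext j
      refine Fin.cases ?_ (fun i => ?_) j <;> simp
    simp only [signAvg_succ, h, neg_neg]
    rw [ih fun e => η (Fin.cons (-1) e), ih fun e => η (Fin.cons 1 e), add_comm]

/-- Cauchy–Schwarz on the cube, with the factorization of `η ^ 2` as hypothesis so that no square
roots appear. -/
theorem signAvg_sq_le_mul {n : ℕ} {η θ χ : (Fin n → ℝ) → ℝ} (hθ : ∀ e, 0 ≤ θ e)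
    (hχ : ∀ e, 0 ≤ χ e) (h : ∀ e, η e ^ 2 = θ e * χ e) :
    signAvg n η ^ 2 ≤ signAvg n θ * signAvg n χ := by
  simp only [signAvg]
  have := Finset.sum_sq_le_sum_mul_sum_of_sq_le_mul (Finset.univ : Finset (Fin n → Bool))
    (r := fun ε => η fun j => signOf (ε j)) (f := fun ε => θ fun j => signOf (ε j))
    (g := fun ε => χ fun j => signOf (ε j)) (fun _ _ => hθ _) (fun _ _ => hχ _)
    (fun _ _ => (h _).le)
  rw [mul_pow, mul_mul_mul_comm, ← sq]
  gcongr

/-! ### The contraction principle -/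

/-- A convex function has larger increments further to the right and over longer intervals. -/
theorem convexOn_add_le_add {G : ℝ → ℝ} (hG : ConvexOn ℝ Set.univ G) (hm : Monotone G)
    {a b a' b' : ℝ} (hba : b ≤ a) (hbb : b ≤ b') (hd : a - b ≤ a' - b') :
    G a + G b' ≤ G b + G a' := by
  -- Both `a` and `b'` lie between `b` and `b' + (a - b)`, as convex combinations with interchanged
  -- weights, so the two convexity inequalities add up. Monotonicity then moves the right endpoint
  -- up to `a'`.
  have key : G (b' + (a - b)) + G b ≥ G a + G b' := by
    rcases eq_or_lt_of_le (show b ≤ b' + (a - b) by linarith) with h | h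
    · have h1 : a = b := by linarith
      have h2 : b' = b := by linarith
      simp [h1, h2]
    · set L := b' + (a - b) - b with hL
      have hLpos : 0 < L := by linarith
      have n1 : 0 ≤ (b' - b) / L := div_nonneg (by linarith) hLpos.le
      have n2 : 0 ≤ (a - b) / L := div_nonneg (by linarith) hLpos.le
      have hs : (a - b) / L + (b' - b) / L = 1 := by
        rw [← add_div, div_eq_one_iff_eq hLpos.ne']; ring
      have e1 := hG.2 (Set.mem_univ b) (Set.mem_univ (b' + (a - b))) n1 n2 (by linarith)
      have e2 := hG.2 (Set.mem_univ b) (Set.mem_univ (b' + (a - b))) n2 n1 hs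
      have s1 : ((b' - b) / L) • b + ((a - b) / L) • (b' + (a - b)) = a := by
        simp only [smul_eq_mul]; field_simp; rw [hL]; ring
      have s2 : ((a - b) / L) • b + ((b' - b) / L) • (b' + (a - b)) = b' := by
        simp only [smul_eq_mul]; field_simp; rw [hL]; ring
      rw [s1] at e1
      rw [s2] at e2
      simp only [smul_eq_mul] at e1 e2
      calc G a + G b' ≤ ((a - b) / L + (b' - b) / L) * (G b + G (b' + (a - b))) := by linarith
        _ = _ := by rw [hs]; ring
  have := hm (show b' + (a - b) ≤ a' by linarith)
  linarith

/-- The two-point inequality behind the contraction principle. -/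
theorem add_le_add_of_contraction {G : ℝ → ℝ} (hG : ConvexOn ℝ Set.univ G) (hm : Monotone G)
    {h₁ a₁ b₁ h₂ a₂ b₂ A B : ℝ} (hab : |a₁ - a₂| ≤ |b₁ - b₂|) (h1 : |a₁| ≤ |b₁|) (h2 : |a₂| ≤ |b₂|)
    (hA₁ : h₁ + b₁ ≤ A) (hA₂ : h₂ + b₂ ≤ A) (hB₁ : h₁ - b₁ ≤ B) (hB₂ : h₂ - b₂ ≤ B)
    (hmax₁ : h₂ + a₂ ≤ h₁ + a₁) (hmax₂ : h₁ - a₁ ≤ h₂ - a₂) :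
    G (h₁ + a₁) + G (h₂ - a₂) ≤ G A + G B := by
  have mA₁ := hm hA₁
  have mA₂ := hm hA₂
  have mB₁ := hm hB₁
  have mB₂ := hm hB₂
  have hab' := abs_le.1 hab
  have h1' := abs_le.1 h1
  have h2' := abs_le.1 h2
  -- If `b₁` and `b₂` have the same sign, the contraction hypothesis compares the lengths of two
  -- intervals, and `convexOn_add_le_add` applies with the longer one further right. If the signs
  -- are opposite, monotonicity alone suffices.
  rcases le_total 0 b₁ with p1 | p1 <;> rcases le_total 0 b₂ with p2 | p2
  · rw [abs_of_nonneg p1] at h1'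
    rw [abs_of_nonneg p2] at h2'
    rcases le_total b₂ b₁ with c | c
    · rw [abs_of_nonneg (by linarith : 0 ≤ b₁ - b₂)] at hab'
      have := convexOn_add_le_add hG hm (a := h₂ - a₂) (b := h₂ - b₂) (a' := h₁ + b₁)
        (b' := h₁ + a₁) (by linarith) (by linarith) (by linarith)
      linarith
    · rw [abs_of_nonpos (by linarith : b₁ - b₂ ≤ 0)] at hab'
      have := convexOn_add_le_add hG hm (a := h₁ + a₁) (b := h₁ - b₁) (a' := h₂ + b₂)
        (b' := h₂ - a₂) (by linarith) (by linarith) (by linarith)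
      linarith
  · rw [abs_of_nonneg p1] at h1'
    rw [abs_of_nonpos p2] at h2'
    have := hm (show h₁ + a₁ ≤ h₁ + b₁ by linarith)
    have := hm (show h₂ - a₂ ≤ h₂ - b₂ by linarith)
    linarith
  · rw [abs_of_nonpos p1] at h1'
    rw [abs_of_nonneg p2] at h2'
    have := hm (show h₁ + a₁ ≤ h₁ - b₁ by linarith)
    have := hm (show h₂ - a₂ ≤ h₂ + b₂ by linarith)
    linarith
  · rw [abs_of_nonpos p1] at h1'
    rw [abs_of_nonpos p2] at h2'
    rcases le_total b₂ b₁ with c | c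
    · rw [abs_of_nonneg (by linarith : 0 ≤ b₁ - b₂)] at hab'
      have := convexOn_add_le_add hG hm (a := h₁ + a₁) (b := h₁ + b₁) (a' := h₂ - b₂)
        (b' := h₂ - a₂) (by linarith) (by linarith) (by linarith)
      linarith
    · rw [abs_of_nonpos (by linarith : b₁ - b₂ ≤ 0)] at hab'
      have := convexOn_add_le_add hG hm (a := h₂ - a₂) (b := h₂ + b₂) (a' := h₁ - b₁)
        (b' := h₁ + a₁) (by linarith) (by linarith) (by linarith)
      linarith

theorem bddAbove_range_of_abs_le {T : Type*} {f : T → ℝ} (hf : ∃ C, ∀ t, |f t| ≤ C) :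
    BddAbove (Set.range f) := by
  obtain ⟨C, hC⟩ := hf
  exact ⟨C, by rintro _ ⟨t, rfl⟩; exact (le_abs_self _).trans (hC t)⟩

theorem exists_abs_add_mul_le {T : Type*} {f g : T → ℝ} (hf : ∃ C, ∀ t, |f t| ≤ C)
    (hg : ∃ C, ∀ t, |g t| ≤ C) (c : ℝ) : ∃ C, ∀ t, |f t + c * g t| ≤ C := by
  obtain ⟨C, hC⟩ := hf
  obtain ⟨D, hD⟩ := hg
  refine ⟨C + |c| * D, fun t => (abs_add_le _ _).trans ?_⟩
  rw [abs_mul]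
  gcongr
  exacts [hC t, hD t]

theorem exists_abs_sum_mul_le {T : Type*} {n : ℕ} {a : Fin n → T → ℝ}
    (ha : ∀ j, ∃ C, ∀ t, |a j t| ≤ C) (e : Fin n → ℝ) :
    ∃ C, ∀ t, |∑ j, e j * a j t| ≤ C := by
  choose C hC using ha
  refine ⟨∑ j, |e j| * C j, fun t => (Finset.abs_sum_le_sum_abs _ _).trans ?_⟩
  refine Finset.sum_le_sum fun j _ => ?_
  rw [abs_mul]
  gcongr
  exact hC j t

/-- One sign is exchanged at a time; `h` carries the contribution of all the others. `G`, being
continuous and monotone, passes inside the suprema, so the left side is a supremum over pairs `(t,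
s)` and the two-point inequality can be applied to each pair. -/
theorem contraction_step {T : Type*} [Nonempty T] {G : ℝ → ℝ} (hG : ConvexOn ℝ Set.univ G)
    (hm : Monotone G) {h a b : T → ℝ} (hh : ∃ C, ∀ t, |h t| ≤ C) (hb : ∃ C, ∀ t, |b t| ≤ C)
    (hab : ∀ s t, |a s - a t| ≤ |b s - b t|) (hab' : ∀ t, |a t| ≤ |b t|) :
    G (⨆ t, (h t + 1 * a t)) + G (⨆ t, (h t + -1 * a t)) ≤
      G (⨆ t, (h t + 1 * b t)) + G (⨆ t, (h t + -1 * b t)) := by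
  have ha : ∃ C, ∀ t, |a t| ≤ C := by
    obtain ⟨C, hC⟩ := hb
    exact ⟨C, fun t => (hab' t).trans (hC t)⟩
  have cont : Continuous G := continuousOn_univ.1 (ConvexOn.continuousOn isOpen_univ hG)
  have bd : ∀ c : ℝ, ∀ g : T → ℝ, (∃ C, ∀ t, |g t| ≤ C) →
      BddAbove (Set.range fun t => h t + c * g t) :=
    fun c g hg => bddAbove_range_of_abs_le (exists_abs_add_mul_le hh hg c)
  rw [Monotone.map_ciSup_of_continuousAt cont.continuousAt hm (bd 1 a ha),
    Monotone.map_ciSup_of_continuousAt cont.continuousAt hm (bd (-1) a ha)]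
  have key : ∀ t s, G (h t + 1 * a t) + G (h s + -1 * a s) ≤
      G (⨆ t, (h t + 1 * b t)) + G (⨆ t, (h t + -1 * b t)) := by
    have A : ∀ t, h t + b t ≤ ⨆ t, (h t + 1 * b t) := fun t => by
      simpa using le_ciSup (bd 1 b hb) t
    have B : ∀ t, h t - b t ≤ ⨆ t, (h t + -1 * b t) := fun t => by
      simpa [sub_eq_add_neg] using le_ciSup (bd (-1) b hb) t
    have aux : ∀ t s, h s + a s ≤ h t + a t → h t - a t ≤ h s - a s →
        G (h t + a t) + G (h s - a s) ≤ G (⨆ t, (h t + 1 * b t)) + G (⨆ t, (h t + -1 * b t)) :=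
      fun t s h1 h2 => add_le_add_of_contraction hG hm (hab t s) (hab' t) (hab' s) (A t) (A s)
        (B t) (B s) h1 h2
    intro t s
    simp only [one_mul, neg_one_mul, ← sub_eq_add_neg] at aux ⊢
    -- The two-point inequality needs `t` to be the better point for `h + a` and `s` the better one
    -- for `h - a`. If one point is better for both, it is used twice; if the roles are reversed,
    -- the points are swapped. Monotonicity of `G` does the rest.
    rcases le_total (h s + a s) (h t + a t) with c1 | c1 <;>
      rcases le_total (h t - a t) (h s - a s) with c2 | c2
    · exact aux t s c1 c2
    · have := aux t t le_rfl le_rfl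
      have := hm c2
      linarith
    · have := aux s s le_rfl le_rfl
      have := hm c1
      linarith
    · have := aux s t c1 c2
      have := hm c2
      have := hm c1
      linarith
  rw [← le_sub_iff_add_le]
  refine ciSup_le fun t => ?_
  rw [le_sub_iff_add_le, add_comm, ← le_sub_iff_add_le]
  refine ciSup_le fun s => ?_
  have := key t s
  linarith

/-- The contraction principle for suprema of Rademacher sums without absolute values. -/
theorem signAvg_iSup_le {T : Type*} [Nonempty T] {G : ℝ → ℝ} (hG : ConvexOn ℝ Set.univ G)
    (hm : Monotone G) {n : ℕ} {a b : Fin n → T → ℝ} (hb : ∀ j, ∃ C, ∀ t, |b j t| ≤ C)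
    (hab : ∀ j s t, |a j s - a j t| ≤ |b j s - b j t|) (hab' : ∀ j t, |a j t| ≤ |b j t|)
    {h : T → ℝ} (hh : ∃ C, ∀ t, |h t| ≤ C) :
    signAvg n (fun e => G (⨆ t, (h t + ∑ j, e j * a j t))) ≤
      signAvg n (fun e => G (⨆ t, (h t + ∑ j, e j * b j t))) := by
  -- `h` must vary: the induction hypothesis is used with the term `± a 0 t` of the first sign
  -- absorbed into `h`.
  induction n generalizing h with
  | zero => simp [signAvg_zero]
  | succ n ih =>
    have ha : ∀ j, ∃ C, ∀ t, |a j t| ≤ C := fun j => by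
      obtain ⟨C, hC⟩ := hb j
      exact ⟨C, fun t => (hab' j t).trans (hC t)⟩
    simp only [signAvg_succ, Fin.sum_univ_succ, Fin.cons_zero, Fin.cons_succ, ← add_assoc]
    have step : ∀ c : ℝ, signAvg n (fun e => G (⨆ t, (h t + c * a 0 t + ∑ j, e j * a j.succ t))) ≤
        signAvg n (fun e => G (⨆ t, (h t + c * a 0 t + ∑ j, e j * b j.succ t))) := fun c =>
      ih (a := fun j => a j.succ) (b := fun j => b j.succ) (fun j => hb _) (fun j => hab _)
        (fun j => hab' _) (exists_abs_add_mul_le hh (ha 0) c)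
    refine (div_le_div_of_nonneg_right (add_le_add (step 1) (step (-1))) zero_le_two).trans ?_
    rw [← signAvg_add, ← signAvg_add]
    refine div_le_div_of_nonneg_right (signAvg_mono fun e => ?_) zero_le_two
    have bs := exists_abs_add_mul_le hh (exists_abs_sum_mul_le (fun j => hb (Fin.succ j)) e) 1
    have := contraction_step hG hm bs (hb 0) (hab 0) (hab' 0)
    simpa only [one_mul, add_right_comm] using this

theorem convexOn_max_zero_rpow {q : ℝ} (hq : 1 ≤ q) :
    ConvexOn ℝ Set.univ fun x : ℝ => (max x 0) ^ q := by
  refine ⟨convex_univ, fun x _ y _ a b ha hb hab => ?_⟩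
  refine le_trans ?_ ((convexOn_rpow hq).2 (le_max_right x 0) (le_max_right y 0) ha hb hab)
  simp only [smul_eq_mul]
  have hx := mul_le_mul_of_nonneg_left (le_max_left x 0) ha
  have hy := mul_le_mul_of_nonneg_left (le_max_left y 0) hb
  exact Real.rpow_le_rpow (le_max_right _ _) (max_le (by linarith) (by positivity)) (by linarith)

/-- The contraction principle for moments of suprema of absolute values of Rademacher sums. -/
theorem signAvg_iSup_abs_rpow_le {T : Type*} [Nonempty T] {q : ℝ} (hq : 1 ≤ q) {n : ℕ}
    {a b : Fin n → T → ℝ} (hb : ∀ j, ∃ C, ∀ t, |b j t| ≤ C)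
    (hab : ∀ j s t, |a j s - a j t| ≤ |b j s - b j t|) (hab' : ∀ j t, |a j t| ≤ |b j t|) :
    signAvg n (fun e => (⨆ t, |∑ j, e j * a j t|) ^ q) ≤
      (2 : ℝ) ^ q * signAvg n (fun e => (⨆ t, |∑ j, e j * b j t|) ^ q) := by
  have ha : ∀ j, ∃ C, ∀ t, |a j t| ≤ C := fun j => by
    obtain ⟨C, hC⟩ := hb j
    exact ⟨C, fun t => (hab' j t).trans (hC t)⟩
  -- A supremum without absolute values may be negative; the positive part makes the power convex
  -- and monotone on all of `ℝ`.
  set G : ℝ → ℝ := fun x => (max x 0) ^ q with hGdef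
  have hG : ConvexOn ℝ Set.univ G := convexOn_max_zero_rpow hq
  have hm : Monotone G := fun x y hxy => by
    simp only [hGdef]
    gcongr
  have main := signAvg_iSup_le hG hm hb hab hab' (h := fun _ => 0) ⟨0, by simp⟩
  simp only [zero_add] at main
  have bdd : ∀ c : Fin n → T → ℝ, (∀ j, ∃ C, ∀ t, |c j t| ≤ C) → ∀ e : Fin n → ℝ,
      BddAbove (Set.range fun t => |∑ j, e j * c j t|) := fun c hc e =>
    bddAbove_range_of_abs_le (by simpa using exists_abs_sum_mul_le hc e)
  -- The absolute value is split into the one-sided suprema at `e` and `-e`. Convexity of the power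
  -- yields `2 ^ q` times the mean of the two terms, which have equal averages because the cube is
  -- symmetric.
  have lower : ∀ e : Fin n → ℝ, (⨆ t, |∑ j, e j * a j t|) ^ q ≤
      2 ^ q * (G (⨆ t, ∑ j, e j * a j t) / 2 + G (⨆ t, ∑ j, (-e) j * a j t) / 2) := by
    intro e
    set A := ⨆ t, ∑ j, e j * a j t with hA
    set B := ⨆ t, ∑ j, (-e) j * a j t with hB
    have hle : (⨆ t, |∑ j, e j * a j t|) ≤ max A 0 + max B 0 := by
      refine ciSup_le fun t => ?_
      have h1 : ∑ j, e j * a j t ≤ A :=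
        le_ciSup (bddAbove_range_of_abs_le (exists_abs_sum_mul_le ha e)) t
      have h2 : ∑ j, (-e) j * a j t ≤ B :=
        le_ciSup (bddAbove_range_of_abs_le (exists_abs_sum_mul_le ha (-e))) t
      simp only [Pi.neg_apply, neg_mul, Finset.sum_neg_distrib] at h2
      refine abs_le.2 ⟨?_, ?_⟩ <;>
        linarith [le_max_left A 0, le_max_right A 0, le_max_left B 0, le_max_right B 0]
    have hnn : 0 ≤ ⨆ t, |∑ j, e j * a j t| := Real.iSup_nonneg fun _ => abs_nonneg _
    have conv := (convexOn_rpow hq).2 (le_max_right A 0) (le_max_right B 0)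
      (one_half_pos (α := ℝ)).le (one_half_pos (α := ℝ)).le (add_halves 1)
    simp only [smul_eq_mul] at conv
    calc (⨆ t, |∑ j, e j * a j t|) ^ q ≤ (2 * (1 / 2 * max A 0 + 1 / 2 * max B 0)) ^ q := by
          refine Real.rpow_le_rpow hnn (hle.trans (le_of_eq (by ring))) (by linarith)
      _ = 2 ^ q * (1 / 2 * max A 0 + 1 / 2 * max B 0) ^ q := by
          rw [Real.mul_rpow (by norm_num) (by positivity)]
      _ ≤ _ := by
          refine mul_le_mul_of_nonneg_left (conv.trans (le_of_eq ?_)) (by positivity)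
          simp only [hGdef]
          ring
  have upper : ∀ e : Fin n → ℝ, G (⨆ t, ∑ j, e j * b j t) ≤ (⨆ t, |∑ j, e j * b j t|) ^ q := by
    intro e
    refine Real.rpow_le_rpow (le_max_right _ _) (max_le ?_ ?_) (by linarith)
    · exact ciSup_mono (bdd b hb e) fun t => le_abs_self _
    · exact Real.iSup_nonneg fun _ => abs_nonneg _
  calc signAvg n (fun e => (⨆ t, |∑ j, e j * a j t|) ^ q)
      ≤ signAvg n (fun e => 2 ^ q * (G (⨆ t, ∑ j, e j * a j t) / 2 +
          G (⨆ t, ∑ j, (-e) j * a j t) / 2)) := signAvg_mono lower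
    _ = (2 : ℝ) ^ q * signAvg n (fun e => G (⨆ t, ∑ j, e j * a j t)) := by
        rw [signAvg_const_mul, signAvg_add,
          signAvg_comp_neg fun e : Fin n → ℝ => G (⨆ t, ∑ j, e j * a j t) / 2, ← signAvg_add]
        simp only [add_halves]
    _ ≤ _ := mul_le_mul_of_nonneg_left (main.trans (signAvg_mono upper)) (by positivity)

/-! ### Kahane's inequality on the cube -/

/-- A hypercontractive estimate on the cube for nonnegative convex functions. -/
theorem signAvg_pow_four_le {F : Type*} [AddCommGroup F] [Module ℝ F] {N : F → ℝ}
    (hN : ConvexOn ℝ Set.univ N) (hN0 : ∀ x, 0 ≤ N x) {n : ℕ} (x : Fin n → F) (y : F) :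
    signAvg n (fun e => N (y + (1 / 2 : ℝ) • ∑ j, e j • x j) ^ 4) ≤
      signAvg n (fun e => N (y + ∑ j, e j • x j) ^ 2) ^ 2 := by
  induction n generalizing y with
  | zero => simp [signAvg_zero, ← pow_mul]
  | succ n ih =>
    set a : (Fin n → ℝ) → ℝ := fun e => N (y + x 0 + (1 / 2 : ℝ) • ∑ j, e j • x j.succ) with ha
    set b : (Fin n → ℝ) → ℝ := fun e => N (y - x 0 + (1 / 2 : ℝ) • ∑ j, e j • x j.succ) with hb
    have a0 : ∀ e, 0 ≤ a e := fun e => hN0 _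
    have b0 : ∀ e, 0 ≤ b e := fun e => hN0 _
    have ia := ih (fun j => x j.succ) (y + x 0)
    have ib := ih (fun j => x j.succ) (y - x 0)
    set A := signAvg n (fun e => N (y + x 0 + ∑ j, e j • x j.succ) ^ 2) with hA
    set B := signAvg n (fun e => N (y - x 0 + ∑ j, e j • x j.succ) ^ 2) with hB
    have A0 : 0 ≤ A := signAvg_nonneg fun _ => sq_nonneg _
    have B0 : 0 ≤ B := signAvg_nonneg fun _ => sq_nonneg _
    -- Cauchy–Schwarz and the induction hypotheses for the base points `y ± x 0` control the mixed
    -- term, which completes the square `(A + B) ^ 2`.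
    have cs : signAvg n (fun e => a e ^ 2 * b e ^ 2) ≤ A * B := by
      have h := signAvg_sq_le_mul (η := fun e => a e ^ 2 * b e ^ 2) (θ := fun e => a e ^ 4)
        (χ := fun e => b e ^ 4) (fun e => by positivity) (fun e => by positivity)
        (fun e => by ring)
      refine le_of_sq_le_sq ?_ (mul_nonneg A0 B0)
      refine h.trans ?_
      rw [mul_pow]
      exact mul_le_mul ia ib (signAvg_nonneg fun e => by positivity) (sq_nonneg _)
    have rhs : signAvg (n + 1) (fun e => N (y + ∑ j, e j • x j) ^ 2) = (A + B) / 2 := by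
      simp only [signAvg_succ, Fin.sum_univ_succ, Fin.cons_zero, Fin.cons_succ, one_smul, neg_smul,
        ← add_assoc, ← sub_eq_add_neg, hA, hB]
    rw [rhs, signAvg_succ, ← signAvg_add]
    -- Halving `x 0` makes the two arguments convex combinations of those of `a` and `b`, with
    -- weights `3/4` and `1/4`. The claim becomes `(3a/4 + b/4)^4 + (a/4 + 3b/4)^4 ≤ (a^2 + b^2)^2 /
    -- 2`.
    have point : ∀ e : Fin n → ℝ,
        N (y + (1 / 2 : ℝ) • ∑ j, (Fin.cons 1 e : Fin (n + 1) → ℝ) j • x j) ^ 4 +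
          N (y + (1 / 2 : ℝ) • ∑ j, (Fin.cons (-1) e : Fin (n + 1) → ℝ) j • x j) ^ 4 ≤
        (1 / 2) * (a e ^ 4 + (2 * (a e ^ 2 * b e ^ 2) + b e ^ 4)) := by
      intro e
      simp only [Fin.sum_univ_succ, Fin.cons_zero, Fin.cons_succ, one_smul, neg_smul]
      set s := ∑ j, e j • x j.succ with hs
      have c1 := hN.2 (Set.mem_univ (y + x 0 + (1 / 2 : ℝ) • s))
        (Set.mem_univ (y - x 0 + (1 / 2 : ℝ) • s)) (show (0 : ℝ) ≤ 3 / 4 by norm_num)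
        (show (0 : ℝ) ≤ 1 / 4 by norm_num) (by norm_num)
      have c2 := hN.2 (Set.mem_univ (y + x 0 + (1 / 2 : ℝ) • s))
        (Set.mem_univ (y - x 0 + (1 / 2 : ℝ) • s)) (show (0 : ℝ) ≤ 1 / 4 by norm_num)
        (show (0 : ℝ) ≤ 3 / 4 by norm_num) (by norm_num)
      have v1 : (3 / 4 : ℝ) • (y + x 0 + (1 / 2 : ℝ) • s) +
          (1 / 4 : ℝ) • (y - x 0 + (1 / 2 : ℝ) • s) = y + (1 / 2 : ℝ) • (x 0 + s) := by module
      have v2 : (1 / 4 : ℝ) • (y + x 0 + (1 / 2 : ℝ) • s) +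
          (3 / 4 : ℝ) • (y - x 0 + (1 / 2 : ℝ) • s) = y + (1 / 2 : ℝ) • (-x 0 + s) := by module
      rw [v1] at c1
      rw [v2] at c2
      simp only [smul_eq_mul] at c1 c2
      have p1 := pow_le_pow_left₀ (hN0 _) c1 4
      have p2 := pow_le_pow_left₀ (hN0 _) c2 4
      change N (y + (1 / 2 : ℝ) • (x 0 + s)) ^ 4 ≤ (3 / 4 * a e + 1 / 4 * b e) ^ 4 at p1
      change N (y + (1 / 2 : ℝ) • (-x 0 + s)) ^ 4 ≤ (1 / 4 * a e + 3 / 4 * b e) ^ 4 at p2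
      refine (add_le_add p1 p2).trans ?_
      nlinarith [sq_nonneg ((a e - b e) * (a e + b e)), sq_nonneg ((a e - b e) ^ 2)]
    refine (div_le_div_of_nonneg_right (signAvg_mono point) zero_le_two).trans ?_
    rw [signAvg_const_mul, signAvg_add, signAvg_add, signAvg_const_mul]
    calc 1 / 2 * (signAvg n (fun e => a e ^ 4) + (2 * signAvg n (fun e => a e ^ 2 * b e ^ 2) +
          signAvg n (fun e => b e ^ 4))) / 2
        ≤ 1 / 2 * (A ^ 2 + (2 * (A * B) + B ^ 2)) / 2 := by gcongr
      _ = ((A + B) / 2) ^ 2 := by ring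

section Kahane

variable {F : Type*} [SeminormedAddCommGroup F] [NormedSpace ℝ F]

/-- The hypercontractive estimate at `y = 0` for the convex function `‖·‖ ^ m`; taking powers of the
norm lets the exponent be doubled repeatedly. -/
theorem signAvg_norm_pow_le (m : ℕ) {n : ℕ} (x : Fin n → F) :
    signAvg n (fun e => ‖∑ j, e j • x j‖ ^ (4 * m)) ≤
      2 ^ (4 * m) * signAvg n (fun e => ‖∑ j, e j • x j‖ ^ (2 * m)) ^ 2 := by
  have h := signAvg_pow_four_le (N := fun v : F => ‖v‖ ^ m)
    (convexOn_univ_norm.pow (fun _ _ => norm_nonneg _) m) (fun v => by positivity) x 0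
  simp only [zero_add, norm_smul, ← pow_mul, mul_pow, signAvg_const_mul, mul_comm m] at h
  rw [show ‖(1 / 2 : ℝ)‖ ^ (4 * m) = (2 ^ (4 * m))⁻¹ by simp, inv_mul_le_iff₀ (by positivity)] at h
  exact h

/-- Interpolation of the second moment between the first and the fourth. Two uses of Cauchy–Schwarz
give `B^4 ≤ A^2 C^2 ≤ A^2 B D`, and `D ≤ 16 B^2` leaves `B ≤ 16 A^2`. -/
theorem signAvg_norm_sq_le {n : ℕ} (x : Fin n → F) :
    signAvg n (fun e => ‖∑ j, e j • x j‖ ^ 2) ≤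
      2 ^ 4 * signAvg n (fun e => ‖∑ j, e j • x j‖) ^ 2 := by
  have h4 := signAvg_norm_pow_le 1 x
  simp only [mul_one] at h4
  set g : (Fin n → ℝ) → ℝ := fun e => ‖∑ j, e j • x j‖ with hg
  have g0 : ∀ e, 0 ≤ g e := fun e => norm_nonneg _
  have c1 := signAvg_sq_le_mul (η := fun e => g e ^ 2) (θ := g) (χ := fun e => g e ^ 3) g0
    (fun e => pow_nonneg (g0 e) 3) (fun e => by ring)
  have c2 := signAvg_sq_le_mul (η := fun e => g e ^ 3) (θ := fun e => g e ^ 2)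
    (χ := fun e => g e ^ 4) (fun e => by positivity) (fun e => by positivity) (fun e => by ring)
  change signAvg n (fun e => g e ^ 4) ≤ 2 ^ 4 * signAvg n (fun e => g e ^ 2) ^ 2 at h4
  change signAvg n (fun e => g e ^ 2) ≤ 2 ^ 4 * signAvg n g ^ 2
  have a1 : 0 ≤ signAvg n g := signAvg_nonneg g0
  have a2 : 0 ≤ signAvg n (fun e => g e ^ 2) := signAvg_nonneg fun e => by positivity
  have a3 : 0 ≤ signAvg n (fun e => g e ^ 3) := signAvg_nonneg fun e => pow_nonneg (g0 e) 3
  set A := signAvg n g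
  set B := signAvg n (fun e => g e ^ 2)
  set C := signAvg n (fun e => g e ^ 3)
  set D := signAvg n (fun e => g e ^ 4)
  rcases eq_or_lt_of_le a2 with h | h
  · rw [← h]; positivity
  have : B ^ 3 * B ≤ B ^ 3 * (2 ^ 4 * A ^ 2) := by
    calc B ^ 3 * B = (B ^ 2) ^ 2 := by ring
      _ ≤ (A * C) ^ 2 := by gcongr
      _ = A ^ 2 * C ^ 2 := by ring
      _ ≤ A ^ 2 * (B * (2 ^ 4 * B ^ 2)) := by gcongr; exact c2.trans (by gcongr)
      _ = _ := by ring
  exact le_of_mul_le_mul_left this (by positivity)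

end Kahane

/-- The constant is chosen before the space, the number of vectors and the vectors, as the
definition of `K_{q,p}` demands. -/
theorem exists_signAvg_norm_two_pow_le (m : ℕ) : ∃ C : ℝ, 0 < C ∧
    ∀ (F : Type u) [SeminormedAddCommGroup F] [NormedSpace ℝ F] (n : ℕ) (x : Fin n → F),
      signAvg n (fun e => ‖∑ j, e j • x j‖ ^ (2 ^ (m + 1))) ≤
        C * signAvg n (fun e => ‖∑ j, e j • x j‖) ^ (2 ^ (m + 1)) := by
  induction m with
  | zero => exact ⟨2 ^ 4, by norm_num, fun F _ _ n x => by simpa using signAvg_norm_sq_le x⟩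
  | succ m ih =>
    obtain ⟨C, hC, h⟩ := ih
    refine ⟨2 ^ (4 * 2 ^ m) * C ^ 2, by positivity, fun F _ _ n x => ?_⟩
    have h1 := signAvg_norm_pow_le (2 ^ m) x
    have h2 := h F n x
    have e1 : 4 * 2 ^ m = 2 ^ (m + 1 + 1) := by ring
    have e2 : 2 * 2 ^ m = 2 ^ (m + 1) := by ring
    rw [e1, e2] at h1
    rw [e1]
    refine h1.trans ?_
    rw [mul_assoc]
    refine mul_le_mul_of_nonneg_left ?_ (by positivity)
    refine (pow_le_pow_left₀ (signAvg_nonneg fun e => by positivity) h2 2).trans (le_of_eq ?_)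
    rw [mul_pow, ← pow_mul, ← pow_succ]

/-! ### Rademacher families and averages over the cube -/

theorem signOf_eq_iff (b : Bool) (x : ℝ) (hx : x = -1 ∨ x = 1) :
    x = signOf b ↔ b = decide (x = 1) := by
  rcases hx with rfl | rfl <;> cases b <;> norm_num [signOf]

theorem IsRademacherFamily.prob_eq_signOf {Ω : Type w} [MeasurableSpace Ω] {P : Measure Ω}
    {r : ℕ → Ω → ℝ} (hr : IsRademacherFamily r P) (n : ℕ) (ε : Fin n → Bool) :
    P {ω | ∀ j : Fin n, r j ω = signOf (ε j)} = 2⁻¹ ^ n := by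
  have hi : iIndepFun (fun j : Fin n => r j) P := hr.indep.precomp Fin.val_injective
  have h := hi.measure_inter_preimage_eq_mul Finset.univ (sets := fun j => {signOf (ε j)})
    (fun j _ => measurableSet_singleton _)
  have hset : {ω | ∀ j : Fin n, r j ω = signOf (ε j)} =
      ⋂ j ∈ (Finset.univ : Finset (Fin n)), r j ⁻¹' {signOf (ε j)} := by
    ext ω
    simp
  rw [hset, h]
  have hj : ∀ j : Fin n, P (r j ⁻¹' {signOf (ε j)}) = 2⁻¹ := by
    intro j
    rw [← one_div]
    cases hb : ε j
    · exact hr.prob_neg_one j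
    · exact hr.prob_one j
  simp [hj]

/-- Each sign pattern has probability `2⁻¹ ^ n` and every `ω` realizes exactly one, so the first `n`
variables are uniform on the cube. -/
theorem IsRademacherFamily.lintegral_eq {Ω : Type w} [MeasurableSpace Ω] {P : Measure Ω}
    {r : ℕ → Ω → ℝ} (hr : IsRademacherFamily r P) {n : ℕ} {η : (Fin n → ℝ) → ℝ}
    (hη : ∀ e, 0 ≤ η e) :
    ∫⁻ ω, ENNReal.ofReal (η fun j => r j ω) ∂P = ENNReal.ofReal (signAvg n η) := by
  classical
  have hpt : ∀ ω, ENNReal.ofReal (η fun j => r j ω) = ∑ ε : Fin n → Bool,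
      Set.indicator {ω | ∀ j : Fin n, r j ω = signOf (ε j)}
        (fun _ => ENNReal.ofReal (η fun j => signOf (ε j))) ω := by
    intro ω
    have hω : ∀ j : Fin n, r j ω = signOf (decide (r j ω = 1)) := fun j =>
      (signOf_eq_iff _ _ (hr.range j ω)).2 rfl
    rw [Finset.sum_eq_single (fun j : Fin n => decide (r j ω = 1))]
    · rw [Set.indicator_of_mem (by exact hω)]
      congr 2
      funext j
      exact hω j
    · intro ε _ hε
      refine Set.indicator_of_notMem (fun hmem => hε ?_) _
      funext j
      exact (signOf_eq_iff _ _ (hr.range j ω)).1 (hmem j)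
    · simp
  have hmeas : ∀ ε : Fin n → Bool, MeasurableSet {ω | ∀ j : Fin n, r j ω = signOf (ε j)} := by
    intro ε
    simp only [Set.ofPred_forall]
    exact MeasurableSet.iInter fun j => hr.measurable j (measurableSet_singleton _)
  simp only [hpt]
  rw [lintegral_finsetSum _ fun ε _ => measurable_const.indicator (hmeas ε)]
  simp only [lintegral_indicator_const (hmeas _), hr.prob_eq_signOf]
  rw [← Finset.sum_mul, signAvg, ENNReal.ofReal_mul (by positivity),
    ENNReal.ofReal_sum_of_nonneg fun _ _ => hη _, mul_comm,
    ENNReal.ofReal_inv_of_pos (by positivity), ENNReal.ofReal_pow (by norm_num), ENNReal.inv_pow]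
  norm_num

theorem IsRademacherFamily.eLpNorm_eq {Ω : Type w} [MeasurableSpace Ω] {P : Measure Ω}
    {r : ℕ → Ω → ℝ} (hr : IsRademacherFamily r P) {F : Type*} [NormedAddCommGroup F]
    [NormedSpace ℝ F] {s : ℝ} (hs : 0 < s) {n : ℕ} (x : Fin n → F) :
    eLpNorm (fun ω => ∑ j : Fin n, r j ω • x j) (ENNReal.ofReal s) P =
      ENNReal.ofReal (signAvg n (fun e => ‖∑ j, e j • x j‖ ^ s) ^ (1 / s)) := by
  rw [eLpNorm_eq_lintegral_rpow_enorm_toReal (by simpa using hs) ENNReal.ofReal_ne_top,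
    ENNReal.toReal_ofReal hs.le,
    ← ENNReal.ofReal_rpow_of_nonneg (signAvg_nonneg fun e => by positivity) (by positivity),
    ← hr.lintegral_eq (η := fun e : Fin n → ℝ => ‖∑ j, e j • x j‖ ^ s) fun e => by positivity]
  congr 2
  funext ω
  rw [← ofReal_norm, ENNReal.ofReal_rpow_of_nonneg (norm_nonneg _) hs.le]

/-- The fair coin on a two-point space. -/
noncomputable def fairCoin : Measure (ULift.{w} Bool) :=
  (2⁻¹ : ℝ≥0∞) • Measure.dirac ⟨true⟩ + (2⁻¹ : ℝ≥0∞) • Measure.dirac ⟨false⟩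

instance : IsProbabilityMeasure fairCoin.{w} :=
  ⟨by simp [fairCoin, ENNReal.inv_two_add_inv_two]⟩

/-- An admissible constant says something about the cube only if a Rademacher family exists in the
universe concerned. Fair coin tosses provide one; completing the product measure keeps the
probabilities and the independence. -/
theorem exists_isRademacherFamily : ∃ (Ω : Type w) (_ : MeasurableSpace Ω) (P : Measure Ω)
    (r : ℕ → Ω → ℝ), IsProbabilityMeasure P ∧ P.IsComplete ∧ IsRademacherFamily r P := by
  let μ : Measure (ℕ → ULift.{w} Bool) := Measure.infinitePi fun _ => fairCoin.{w}
  let r : ℕ → (ℕ → ULift.{w} Bool) → ℝ := fun j ω => signOf (ω j).down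
  have hs : Measurable fun b : ULift.{w} Bool => signOf b.down :=
    (measurable_of_countable signOf).comp measurable_down
  have hr : ∀ j, Measurable (r j) := fun j => hs.comp (measurable_pi_apply j)
  have hprob : ∀ (b : Bool) j, μ {ω | r j ω = signOf b} = 1 / 2 := by
    intro b j
    have hpre : {ω | r j ω = signOf b} =
        (fun ω : ℕ → ULift.{w} Bool => ω j) ⁻¹' {c | signOf c.down = signOf b} := rfl
    have hm : MeasurableSet {c : ULift.{w} Bool | signOf c.down = signOf b} :=
      hs (measurableSet_singleton _)
    rw [hpre, (measurePreserving_eval_infinitePi (fun _ => fairCoin.{w}) j).measure_preimage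
      hm.nullMeasurableSet]
    simp only [fairCoin, Measure.add_apply, Measure.smul_apply, Measure.dirac_apply' _ hm]
    cases b <;> norm_num [signOf, Set.indicator]
  refine ⟨NullMeasurableSpace (ℕ → ULift.{w} Bool) μ, inferInstance, μ.completion, r,
    ⟨measure_univ (μ := μ)⟩, inferInstance, ?_⟩
  refine ⟨fun j s hs => (hr j hs).nullMeasurableSet, fun j ω => ?_, fun j => ?_, fun j => ?_, ?_⟩
  · change signOf _ = _ ∨ signOf _ = _
    cases (ω j).down <;> simp [signOf]
  · exact hprob false j
  · exact hprob true j
  · have hi : iIndepFun r μ := iIndepFun_infinitePi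
      (X := fun _ (b : ULift.{w} Bool) => signOf b.down) fun _ => hs
    exact iIndepFun_iff_measure_inter_preimage_eq_mul.2
      (iIndepFun_iff_measure_inter_preimage_eq_mul.1 hi)

/-! ### The constants -/

/-- The `L_q` norm is raised to `L_N` with `N` a power of two, compared there with `L_1`, and `L_1`
is below `L_p`. Without this, `K_{q,p}` might be the infimum of the empty set, which is `0` by
convention. -/
theorem exists_isKahaneKhintchineBound {p q : ℝ} (hp : 1 ≤ p) (hpq : p ≤ q) :
    ∃ K, IsKahaneKhintchineBound.{u, w} q p K := by
  obtain ⟨m, hm⟩ := pow_unbounded_of_one_lt q (one_lt_two (α := ℝ))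
  obtain ⟨C, hC, h⟩ := exists_signAvg_norm_two_pow_le.{u} m
  set N : ℕ := 2 ^ (m + 1) with hN
  have hN0 : (0 : ℝ) < (N : ℝ) := by positivity
  have hqN : q ≤ N := by
    rw [hN]
    push_cast
    rw [pow_succ]
    linarith [pow_pos (zero_lt_two (α := ℝ)) m]
  refine ⟨C ^ (1 / (N : ℝ)), by positivity, ?_⟩
  intro Ω _ P _ _ r hr F _ _ _ n x
  have hmeas : AEStronglyMeasurable (fun ω => ∑ j : Fin n, r j ω • x j) P :=
    (Finset.stronglyMeasurable_fun_sum Finset.univ fun (j : Fin n) _ =>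
      (hr.measurable j).stronglyMeasurable.smul_const (x j)).aestronglyMeasurable
  calc eLpNorm (fun ω => ∑ j : Fin n, r j ω • x j) (ENNReal.ofReal q) P
      ≤ eLpNorm (fun ω => ∑ j : Fin n, r j ω • x j) (ENNReal.ofReal N) P :=
        eLpNorm_le_eLpNorm_of_exponent_le (ENNReal.ofReal_le_ofReal hqN) hmeas
    _ ≤ ENNReal.ofReal (C ^ (1 / (N : ℝ))) *
        eLpNorm (fun ω => ∑ j : Fin n, r j ω • x j) (ENNReal.ofReal 1) P := by
        rw [hr.eLpNorm_eq hN0, hr.eLpNorm_eq one_pos, ← ENNReal.ofReal_mul (by positivity)]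
        refine ENNReal.ofReal_le_ofReal ?_
        have h0 : 0 ≤ signAvg n (fun e => ‖∑ j, e j • x j‖) := signAvg_nonneg fun e => by positivity
        simp only [Real.rpow_natCast, Real.rpow_one, div_one]
        refine (Real.rpow_le_rpow (signAvg_nonneg fun e => by positivity) (h F n x)
          (by positivity)).trans (le_of_eq ?_)
        rw [Real.mul_rpow hC.le (by positivity), ← Real.rpow_natCast, ← Real.rpow_mul h0,
          mul_one_div_cancel hN0.ne', Real.rpow_one]
    _ ≤ _ := by
        gcongr
        exact eLpNorm_le_eLpNorm_of_exponent_le (ENNReal.ofReal_le_ofReal hp) hmeas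

/-- Shows that the infimum of the admissible constants is itself admissible; if `B = 0`, any single
member of `S` decides the matter. -/
theorem le_sInf_mul {S : Set ℝ} (hS : S.Nonempty) {A B : ℝ} (hB : 0 ≤ B)
    (h : ∀ K ∈ S, A ≤ K * B) : A ≤ sInf S * B := by
  rcases hB.eq_or_lt with rfl | hB
  · obtain ⟨K, hK⟩ := hS
    simpa using h K hK
  · rw [← div_le_iff₀ hB]
    exact le_csInf hS fun K hK => (div_le_iff₀ hB).2 (h K hK)

theorem kahaneKhintchineConst_nonneg (q p : ℝ) : 0 ≤ kahaneKhintchineConst.{u, w} q p :=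
  Real.sInf_nonneg fun _ h => h.1.le

theorem typeConst_nonneg (F : Type u) [NormedAddCommGroup F] [NormedSpace ℝ F] (p : ℝ) :
    0 ≤ typeConst.{u, w} F p :=
  Real.sInf_nonneg fun _ h => h.1.le

theorem khintchineConst_nonneg (q : ℝ) : 0 ≤ khintchineConst.{w} q :=
  Real.sInf_nonneg fun _ h => h.1.le

theorem signAvg_rpow_le_kahaneKhintchineConst {p q : ℝ} (hp : 1 ≤ p) (hpq : p ≤ q) {F : Type u}
    [NormedAddCommGroup F] [NormedSpace ℝ F] [CompleteSpace F] {n : ℕ} (x : Fin n → F) :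
    signAvg n (fun e => ‖∑ j, e j • x j‖ ^ q) ^ (1 / q) ≤
      kahaneKhintchineConst.{u, w} q p * signAvg n (fun e => ‖∑ j, e j • x j‖ ^ p) ^ (1 / p) := by
  obtain ⟨Ω, _, P, r, _, _, hr⟩ := exists_isRademacherFamily.{w}
  have h0 : ∀ s : ℝ, 0 ≤ signAvg n (fun e => ‖∑ j, e j • x j‖ ^ s) ^ (1 / s) := fun s =>
    Real.rpow_nonneg (signAvg_nonneg fun e => by positivity) _
  refine le_sInf_mul (exists_isKahaneKhintchineBound.{u, w} hp hpq) (h0 p) fun K hK => ?_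
  have := hK.2 Ω P r hr F n x
  rwa [hr.eLpNorm_eq (by linarith), hr.eLpNorm_eq (by linarith), ← ENNReal.ofReal_mul hK.1.le,
    ENNReal.ofReal_le_ofReal_iff (mul_nonneg hK.1.le (h0 p))] at this

theorem signAvg_rpow_le_typeConst {p : ℝ} (hp : 1 ≤ p) {F : Type u} [NormedAddCommGroup F]
    [NormedSpace ℝ F] (hF : HasRademacherType.{u, w} F p) {n : ℕ} (x : Fin n → F) :
    signAvg n (fun e => ‖∑ j, e j • x j‖ ^ p) ^ (1 / p) ≤
      typeConst.{u, w} F p * (∑ j, ‖x j‖ ^ p) ^ (1 / p) := by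
  obtain ⟨Ω, _, P, r, _, _, hr⟩ := exists_isRademacherFamily.{w}
  have h0 : 0 ≤ (∑ j, ‖x j‖ ^ p) ^ (1 / p) := by positivity
  refine le_sInf_mul hF h0 fun τ hτ => ?_
  have := hτ.2 Ω P r hr n x
  rwa [hr.eLpNorm_eq (by linarith), ENNReal.ofReal_le_ofReal_iff (mul_nonneg hτ.1.le h0)] at this

/-- The `q`-th moment of Rademacher sums in a space of type `p`. -/
theorem signAvg_rpow_le_of_type {p q : ℝ} (hp : 1 ≤ p) (hpq : p ≤ q) {F : Type u}
    [NormedAddCommGroup F] [NormedSpace ℝ F] [CompleteSpace F]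
    (hF : HasRademacherType.{u, w} F p) {n : ℕ} (x : Fin n → F) :
    signAvg n (fun e => ‖∑ j, e j • x j‖ ^ q) ≤
      (kahaneKhintchineConst.{u, w} q p * typeConst.{u, w} F p) ^ q *
        (∑ j, ‖x j‖ ^ p) ^ (q / p) := by
  have hq : 0 < q := by linarith
  have hK := kahaneKhintchineConst_nonneg.{u, w} q p
  have hτ := typeConst_nonneg.{u, w} F p
  have h0 : 0 ≤ signAvg n (fun e => ‖∑ j, e j • x j‖ ^ q) := signAvg_nonneg fun e => by positivity
  have h := (signAvg_rpow_le_kahaneKhintchineConst.{u, w} hp hpq x).trans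
    (mul_le_mul_of_nonneg_left (signAvg_rpow_le_typeConst.{u, w} hp hF x) hK)
  have hpow := Real.rpow_le_rpow (Real.rpow_nonneg h0 _) h hq.le
  rw [← Real.rpow_mul h0, one_div_mul_cancel hq.ne', Real.rpow_one, ← mul_assoc,
    Real.mul_rpow (by positivity) (by positivity), ← Real.rpow_mul (by positivity)] at hpow
  rwa [one_div_mul_eq_div] at hpow

/-! ### Symmetrization -/

section Symmetrization

variable {X : Type*} [MeasurableSpace X] {μ : Measure X} [IsProbabilityMeasure μ]
  {F : Type*} [NormedAddCommGroup F] [NormedSpace ℝ F]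

theorem lintegral_rpow_le {q : ℝ} (hq : 1 ≤ q) {g : X → ℝ≥0∞} (hg : AEMeasurable g μ) :
    (∫⁻ x, g x ∂μ) ^ q ≤ ∫⁻ x, g x ^ q ∂μ := by
  have h := eLpNorm'_le_eLpNorm'_of_exponent_le (f := g) (μ := μ) one_pos hq
    hg.aestronglyMeasurable
  simp only [eLpNorm', enorm_eq_self, ENNReal.rpow_one, div_one] at h
  have := ENNReal.rpow_le_rpow h (show 0 ≤ q by linarith)
  rwa [← ENNReal.rpow_mul, one_div_mul_cancel (by linarith), ENNReal.rpow_one] at this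

theorem aestronglyMeasurable_sum_smul {ι : Type*} [Fintype ι] {Y : X → F}
    (hY : AEStronglyMeasurable Y μ) (c : ι → ℝ) :
    AEStronglyMeasurable (fun x : ι → X => ∑ j, c j • Y (x j)) (Measure.pi fun _ => μ) := by
  refine Finset.aestronglyMeasurable_fun_sum _ fun j _ => AEStronglyMeasurable.const_smul ?_ _
  exact hY.comp_quasiMeasurePreserving
    (measurePreserving_eval (fun _ => μ) j).quasiMeasurePreserving

theorem measurePreserving_swap_if (b : Bool) :
    MeasurePreserving (fun z : X × X => if b then z else z.swap) (μ.prod μ) (μ.prod μ) := by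
  cases b
  · simpa using Measure.measurePreserving_swap (μ := μ) (ν := μ)
  · exact MeasurePreserving.id (μ.prod μ)

/-- Moments of sums of centred independent variables are dominated by those of the
differences of two independent copies. -/
theorem lintegral_centred_le {ι : Type*} [Fintype ι] {q : ℝ} (hq : 1 ≤ q) {Y : X → F}
    [CompleteSpace F] (hY : Integrable Y μ) :
    ∫⁻ x : ι → X, ‖∑ j, (∫ y, Y y ∂μ - Y (x j))‖ₑ ^ q ∂(Measure.pi fun _ => μ) ≤
      ∫⁻ z : ι → X × X, ‖∑ j, (Y (z j).2 - Y (z j).1)‖ₑ ^ q ∂(Measure.pi fun _ => μ.prod μ) := by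
  set ν : Measure (ι → X) := Measure.pi fun _ => μ with hν
  have hev : ∀ j, MeasurePreserving (fun x : ι → X => x j) ν μ :=
    fun j => measurePreserving_eval (fun _ => μ) j
  have hYj : ∀ j, Integrable (fun x : ι → X => Y (x j)) ν := fun j =>
    (hev j).integrable_comp_of_integrable hY
  have hmean : ∀ j, ∫ x, Y (x j) ∂ν = ∫ y, Y y ∂μ := fun j => by
    rw [← (hev j).map_eq, integral_map (hev j).measurable.aemeasurable]
    rw [(hev j).map_eq]
    exact hY.aestronglyMeasurable
  -- The mean is the integral over an independent copy `x'`, so Jensen's inequality for the `q`-th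
  -- power applies to the whole sum.
  have hint : ∀ x : ι → X, ∑ j, (∫ y, Y y ∂μ - Y (x j)) =
      ∫ x', ∑ j, (Y (x' j) - Y (x j)) ∂ν := by
    intro x
    rw [integral_finsetSum (f := fun j (x' : ι → X) => Y (x' j) - Y (x j)) _ fun j _ =>
      (hYj j).sub (integrable_const _)]
    refine Finset.sum_congr rfl fun j _ => ?_
    rw [integral_sub (hYj j) (integrable_const _), hmean j]
    simp
  have hm1 : AEStronglyMeasurable (fun z : (ι → X) × (ι → X) =>
      ∑ j, (Y (z.2 j) - Y (z.1 j))) (ν.prod ν) := by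
    refine Finset.aestronglyMeasurable_fun_sum _ fun j _ => AEStronglyMeasurable.sub ?_ ?_
    · exact (hYj j).aestronglyMeasurable.comp_snd
    · exact (hYj j).aestronglyMeasurable.comp_fst
  calc ∫⁻ x, ‖∑ j, (∫ y, Y y ∂μ - Y (x j))‖ₑ ^ q ∂ν
      ≤ ∫⁻ x, ∫⁻ x', ‖∑ j, (Y (x' j) - Y (x j))‖ₑ ^ q ∂ν ∂ν := by
        refine lintegral_mono fun x => ?_
        rw [hint x]
        refine (ENNReal.rpow_le_rpow (enorm_integral_le_lintegral_enorm _) (by linarith)).trans ?_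
        refine lintegral_rpow_le hq (AEStronglyMeasurable.enorm ?_)
        exact Finset.aestronglyMeasurable_fun_sum _ fun j _ =>
          (hYj j).aestronglyMeasurable.sub aestronglyMeasurable_const
    _ = ∫⁻ z, ‖∑ j, (Y (z.2 j) - Y (z.1 j))‖ₑ ^ q ∂(ν.prod ν) := by
        rw [lintegral_prod _ (hm1.enorm.pow_const q)]
    _ = _ := by
        have hmp := measurePreserving_arrowProdEquivProdArrow X X ι (fun _ => μ) (fun _ => μ)
        rw [← hmp.lintegral_comp_emb (MeasurableEquiv.measurableEmbedding _)]
        rfl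

/-- Symmetrization: the sign-averaged moments dominate the moments of the centred sum. -/
theorem lintegral_symmetrization {n : ℕ} {q : ℝ} (hq : 1 ≤ q) {Y : X → F}
    [CompleteSpace F] (hY : Integrable Y μ) :
    ∫⁻ x : Fin n → X, ‖∑ j, (∫ y, Y y ∂μ - Y (x j))‖ₑ ^ q ∂(Measure.pi fun _ => μ) ≤
      2 ^ q * ∫⁻ x : Fin n → X,
        ENNReal.ofReal (signAvg n fun e => ‖∑ j, e j • Y (x j)‖ ^ q) ∂(Measure.pi fun _ => μ) := by
  have hq0 : 0 ≤ q := by linarith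
  refine (lintegral_centred_le hq hY).trans ?_
  set ν : Measure (Fin n → X) := Measure.pi fun _ => μ with hν
  set ρ : Measure (Fin n → X × X) := Measure.pi fun _ => μ.prod μ with hρ
  set I := ∫⁻ z : Fin n → X × X, ‖∑ j, (Y (z j).2 - Y (z j).1)‖ₑ ^ q ∂ρ with hI
  set J : (Fin n → Bool) → ℝ≥0∞ := fun ε => ∫⁻ x, ‖∑ j, signOf (ε j) • Y (x j)‖ₑ ^ q ∂ν with hJ
  have hfst : MeasurePreserving (fun (z : Fin n → X × X) j => (z j).1) ρ ν :=
    measurePreserving_pi (fun _ => μ.prod μ) (fun _ => μ) fun _ => measurePreserving_fst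
  have hsnd : MeasurePreserving (fun (z : Fin n → X × X) j => (z j).2) ρ ν :=
    measurePreserving_pi (fun _ => μ.prod μ) (fun _ => μ) fun _ => measurePreserving_snd
  have hmS : ∀ ε : Fin n → Bool,
      AEStronglyMeasurable (fun x : Fin n → X => ∑ j, signOf (ε j) • Y (x j)) ν := fun ε =>
    aestronglyMeasurable_sum_smul hY.aestronglyMeasurable _
  have hcomp : ∀ (ε : Fin n → Bool) {g : (Fin n → X × X) → Fin n → X}, MeasurePreserving g ρ ν →
      ∫⁻ z, ‖∑ j, signOf (ε j) • Y (g z j)‖ₑ ^ q ∂ρ = J ε := by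
    intro ε g hg
    have hm : AEMeasurable (fun x : Fin n → X => ‖∑ j, signOf (ε j) • Y (x j)‖ₑ ^ q)
        (Measure.map g ρ) := by
      rw [hg.map_eq]
      exact (hmS ε).enorm.pow_const q
    simp only [hJ, ← hg.map_eq]
    rw [lintegral_map' hm hg.measurable.aemeasurable]
  -- Swapping the two entries of the pairs with sign `-1` preserves the product measure and negates
  -- exactly those differences.
  have hflip : ∀ ε : Fin n → Bool,
      I = ∫⁻ z : Fin n → X × X, ‖∑ j, signOf (ε j) • (Y (z j).2 - Y (z j).1)‖ₑ ^ q ∂ρ := by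
    intro ε
    have hmp : MeasurePreserving (fun (z : Fin n → X × X) j => if ε j then z j else (z j).swap)
        ρ ρ := measurePreserving_pi (fun _ => μ.prod μ) (fun _ => μ.prod μ)
          fun j => measurePreserving_swap_if (ε j)
    have hm : AEMeasurable (fun z : Fin n → X × X => ‖∑ j, (Y (z j).2 - Y (z j).1)‖ₑ ^ q) ρ := by
      refine AEMeasurable.pow_const (AEStronglyMeasurable.enorm ?_) q
      refine Finset.aestronglyMeasurable_fun_sum _ fun j _ => ?_
      have hd : AEStronglyMeasurable (fun z : X × X => Y z.2 - Y z.1) (μ.prod μ) :=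
        hY.aestronglyMeasurable.comp_snd.sub hY.aestronglyMeasurable.comp_fst
      exact hd.comp_quasiMeasurePreserving
        (measurePreserving_eval (fun _ => μ.prod μ) j).quasiMeasurePreserving
    rw [hI]
    conv_lhs => rw [← hmp.map_eq]
    rw [lintegral_map' (by rwa [hmp.map_eq]) hmp.measurable.aemeasurable]
    refine lintegral_congr fun z => ?_
    congr 3
    funext j
    cases hb : ε j <;> simp [signOf, hb]
  -- The two halves of the difference have the same law, each contributing `J ε`; with the convexity
  -- factor `2 ^ (q - 1)` this makes `2 ^ q`.
  have hbound : ∀ ε : Fin n → Bool, I ≤ 2 ^ q * J ε := by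
    intro ε
    have hpt : ∀ z : Fin n → X × X, ‖∑ j, signOf (ε j) • (Y (z j).2 - Y (z j).1)‖ₑ ^ q ≤
        2 ^ (q - 1) * (‖∑ j, signOf (ε j) • Y (z j).2‖ₑ ^ q +
          ‖∑ j, signOf (ε j) • Y (z j).1‖ₑ ^ q) := by
      intro z
      simp only [smul_sub, Finset.sum_sub_distrib]
      exact (ENNReal.rpow_le_rpow (enorm_sub_le) hq0).trans
        (ENNReal.rpow_add_le_mul_rpow_add_rpow _ _ hq)
    rw [hflip ε]
    refine (lintegral_mono hpt).trans ?_
    have hm2 : AEMeasurable (fun z : Fin n → X × X => ‖∑ j, signOf (ε j) • Y (z j).2‖ₑ ^ q) ρ :=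
      ((hmS ε).comp_quasiMeasurePreserving hsnd.quasiMeasurePreserving).enorm.pow_const q
    rw [lintegral_const_mul' _ _ (by finiteness), lintegral_add_left' hm2, hcomp ε hsnd,
      hcomp ε hfst, ← two_mul, ← mul_assoc]
    refine mul_le_mul_left (le_of_eq ?_) _
    nth_rewrite 2 [← ENNReal.rpow_one 2]
    rw [← ENNReal.rpow_add _ _ two_ne_zero ENNReal.ofNat_ne_top, sub_add_cancel]
  have havg : ∫⁻ x, ENNReal.ofReal (signAvg n fun e => ‖∑ j, e j • Y (x j)‖ ^ q) ∂ν =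
      (2 ^ n)⁻¹ * ∑ ε, J ε := by
    have hpt : ∀ x : Fin n → X, ENNReal.ofReal (signAvg n fun e => ‖∑ j, e j • Y (x j)‖ ^ q) =
        (2 ^ n)⁻¹ * ∑ ε : Fin n → Bool, ‖∑ j, signOf (ε j) • Y (x j)‖ₑ ^ q := by
      intro x
      rw [signAvg, ENNReal.ofReal_mul (by positivity),
        ENNReal.ofReal_sum_of_nonneg fun _ _ => by positivity,
        ENNReal.ofReal_inv_of_pos (by positivity), ENNReal.ofReal_pow (by norm_num)]
      simp only [← ENNReal.ofReal_rpow_of_nonneg (norm_nonneg _) hq0, ofReal_norm]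
      norm_num
    simp only [hpt]
    rw [lintegral_const_mul' _ _ (by simp), lintegral_finsetSum' _ fun ε _ =>
      (hmS ε).enorm.pow_const q]
  -- `I` does not depend on `ε`, so averaging the bound over all patterns keeps it on the left.
  rw [havg, mul_left_comm, Finset.mul_sum]
  have hsum : ∑ _ε : Fin n → Bool, I ≤ ∑ ε : Fin n → Bool, 2 ^ q * J ε :=
    Finset.sum_le_sum fun ε _ => hbound ε
  rw [Finset.sum_const, Finset.card_univ] at hsum
  simp only [Fintype.card_pi, Fintype.card_bool, Finset.prod_const, Finset.card_univ,
    Fintype.card_fin, nsmul_eq_mul] at hsum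
  push_cast at hsum
  calc I = (2 ^ n)⁻¹ * (2 ^ n * I) := by
        rw [← mul_assoc, ENNReal.inv_mul_cancel (by simp) (by simp), one_mul]
    _ ≤ _ := by gcongr

end Symmetrization

/-! ### Tensor powers -/

section TensorPower

variable {k : ℕ} {E : Type u} [NormedAddCommGroup E] [NormedSpace ℝ E]

/-- The canonical multilinear map into the injectively normed algebraic tensor product. -/
noncomputable def algTprod (k : ℕ) (E : Type u) [NormedAddCommGroup E] [NormedSpace ℝ E] :
    MultilinearMap ℝ (fun _ : Fin k => E) (AlgTensor k E) :=
  (PiTensorProduct.tprod ℝ : MultilinearMap ℝ (fun _ : Fin k => E) (⨂[ℝ] _ : Fin k, E))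

theorem norm_algTprod_le (x : Fin k → E) : ‖algTprod k E x‖ ≤ 1 * ∏ i, ‖x i‖ := by
  rw [one_mul]
  refine AlgTensor.norm_le _ _ fun f hf => ?_
  refine (congrArg _ (dualTensor_tprod f x)).trans_le ?_
  rw [Finset.abs_prod]
  exact Finset.prod_le_prod (fun _ _ => abs_nonneg _) fun i _ => by
    simpa using (f i).le_of_opNorm_le (hf i) (x i)

theorem norm_tensorPow_le (x : E) : ‖tensorPow k x‖ ≤ ‖x‖ ^ k := by
  rw [tensorPow, UniformSpace.Completion.norm_coe]
  refine (norm_algTprod_le fun _ : Fin k => x).trans (le_of_eq ?_)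
  simp

theorem continuous_tensorPow : Continuous (tensorPow k : E → InjTensor k E) := by
  have h : Continuous fun x : E => algTprod k E fun _ => x :=
    ((algTprod k E).mkContinuous 1 norm_algTprod_le).cont.comp
      (continuous_pi fun _ => continuous_id)
  exact (UniformSpace.Completion.continuous_coe _).comp h

theorem symmetrize_tprod_const (x : E) :
    symmetrize k E (PiTensorProduct.tprod ℝ fun _ => x) = PiTensorProduct.tprod ℝ fun _ => x := by
  rw [symmetrize_tprod, Finset.sum_const, Finset.card_univ, Fintype.card_perm, Fintype.card_fin,
    ← Nat.cast_smul_eq_nsmul ℝ, smul_smul, inv_mul_cancel₀ (by positivity), one_smul]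

theorem symProj_tensorPow (x : E) : symProj k E (tensorPow k x) = symTensorPow k x := by
  have h : symProjAlgₗ k E (AlgTensor.pow k x) = SymAlgTensor.pow k x :=
    Subtype.ext (symmetrize_tprod_const x)
  rw [symProj, tensorPow, symTensorPow, ← h]
  exact ContinuousLinearMap.completion_apply_coe _ _

theorem continuous_symTensorPow : Continuous (symTensorPow k : E → SymInjTensor k E) := by
  have := (symProj k E).continuous.comp (continuous_tensorPow (k := k) (E := E))
  exact this.congr fun x => symProj_tensorPow x

theorem norm_symTensorPow_le (x : E) : ‖symTensorPow k x‖ ≤ ‖x‖ ^ k := by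
  rw [symTensorPow, UniformSpace.Completion.norm_coe]
  refine SymAlgTensor.norm_le _ _ fun f hf => ?_
  refine (congrArg _ (dualTensor_tprod (fun _ => f) fun _ => x)).trans_le ?_
  rw [Finset.prod_const, Finset.card_univ, Fintype.card_fin, abs_pow]
  gcongr
  simpa using f.le_of_opNorm_le hf x

/-- Presents the norm as a supremum of scalar sums indexed by the dual unit ball, the form required
by the contraction principle. -/
theorem norm_sum_smul_symTensorPow {n : ℕ} (c : Fin n → ℝ) (x : Fin n → E) :
    ‖∑ j, c j • symTensorPow k (x j)‖ =
      ⨆ f : {f : StrongDual ℝ E // ‖f‖ ≤ 1}, |∑ j, c j * f.1 (x j) ^ k| := by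
  have hcoe : ∑ j, c j • symTensorPow k (x j) =
      ((∑ j, c j • SymAlgTensor.pow k (x j) : SymAlgTensor k E) : SymInjTensor k E) := by
    change _ = UniformSpace.Completion.toComplₗᵢ (𝕜 := ℝ) _
    rw [map_sum]
    simp only [map_smul]
    rfl
  rw [hcoe, UniformSpace.Completion.norm_coe]
  refine iSup_congr fun f => congrArg _ ?_
  rw [map_sum]
  refine (map_sum (dualTensor fun _ => f.1) _ _).trans (Finset.sum_congr rfl fun j _ => ?_)
  rw [map_smul]
  refine ((dualTensor fun _ => f.1).map_smul (c j) _).trans ?_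
  rw [smul_eq_mul]
  congr 1
  refine (dualTensor_tprod (fun _ => f.1) fun _ => x j).trans ?_
  simp

/-- A closed convex set contains the mean of a random element taking values in it; this places the
moment among the symmetric tensors. -/
theorem convex_symPart : Convex ℝ (symPart k E) := by
  let L : SymAlgTensor k E →ₗ[ℝ] InjTensor k E :=
    (UniformSpace.Completion.toComplₗᵢ (𝕜 := ℝ) (E := AlgTensor k E)).toLinearMap ∘ₗ symIncl k E
  exact (LinearMap.range L).convex.closure

theorem tensorPow_mem_symPart (x : E) : tensorPow k x ∈ symPart k E :=
  subset_closure ⟨SymAlgTensor.pow k x, rfl⟩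

/-- Contraction principle for Rademacher sums of tensor powers. -/
theorem signAvg_symTensorPow_le {q : ℝ} (hq : 1 ≤ q) (hk : 1 ≤ k) {n : ℕ} (x : Fin n → E) :
    signAvg n (fun e => ‖∑ j, e j • symTensorPow k (x j)‖ ^ q) ≤
      (2 * k) ^ q * signAvg n (fun e => ‖∑ j, e j • (‖x j‖ ^ (k - 1) • x j)‖ ^ q) := by
  have : Nonempty {f : StrongDual ℝ E // ‖f‖ ≤ 1} := ⟨⟨0, by simp⟩⟩
  have hfx : ∀ (f : {f : StrongDual ℝ E // ‖f‖ ≤ 1}) (y : E), |f.1 y| ≤ ‖y‖ := fun f y => by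
    simpa using f.1.le_of_opNorm_le f.2 y
  -- The Lipschitz bound for `t ↦ t ^ k` on `[-‖y‖, ‖y‖]`, written as domination by a linear
  -- function.
  have lip : ∀ (y : E) (s t : ℝ), |s| ≤ ‖y‖ → |t| ≤ ‖y‖ →
      |s ^ k - t ^ k| ≤ |k * ‖y‖ ^ (k - 1) * s - k * ‖y‖ ^ (k - 1) * t| := by
    intro y s t hs ht
    rw [← mul_sub, abs_mul, abs_of_nonneg (by positivity : 0 ≤ (k : ℝ) * ‖y‖ ^ (k - 1))]
    refine (abs_pow_sub_pow_le s t k).trans ?_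
    calc |s - t| * k * max |s| |t| ^ (k - 1) ≤ |s - t| * k * ‖y‖ ^ (k - 1) := by
          gcongr
          exact max_le hs ht
      _ = _ := by ring
  have key := signAvg_iSup_abs_rpow_le (T := {f : StrongDual ℝ E // ‖f‖ ≤ 1}) hq
    (a := fun j f => f.1 (x j) ^ k) (b := fun j f => k * ‖x j‖ ^ (k - 1) * f.1 (x j))
    (fun j => ⟨k * ‖x j‖ ^ (k - 1) * ‖x j‖, fun f => by
      rw [abs_mul, abs_of_nonneg (by positivity : 0 ≤ (k : ℝ) * ‖x j‖ ^ (k - 1))]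
      gcongr
      exact hfx f _⟩)
    (fun j f g => lip (x j) _ _ (hfx f _) (hfx g _))
    -- The Lipschitz bound against `t = 0`; `k ≥ 1` is needed for `0 ^ k = 0`.
    (fun j f => by
      simpa [zero_pow (by omega : k ≠ 0)] using lip (x j) _ 0 (hfx f _) (by simp))
  simp only [norm_sum_smul_symTensorPow]
  refine key.trans ?_
  rw [Real.mul_rpow (by norm_num) (by positivity), mul_assoc]
  refine mul_le_mul_of_nonneg_left ?_ (by positivity)
  rw [← signAvg_const_mul]
  refine signAvg_mono fun e => ?_
  rw [← Real.mul_rpow (by positivity) (norm_nonneg _)]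
  refine Real.rpow_le_rpow (Real.iSup_nonneg fun _ => abs_nonneg _) ?_ (by linarith)
  refine ciSup_le fun f => ?_
  -- The comparison sum is linear in `f`, so its supremum over the dual ball is at most `k` times a
  -- norm in `E`.
  have hsum : ∑ j, e j * (k * ‖x j‖ ^ (k - 1) * f.1 (x j)) =
      k * f.1 (∑ j, e j • (‖x j‖ ^ (k - 1) • x j)) := by
    rw [map_sum, Finset.mul_sum]
    refine Finset.sum_congr rfl fun j _ => ?_
    simp only [map_smul, smul_eq_mul]
    ring
  rw [hsum, abs_mul, Nat.abs_cast]
  gcongr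
  exact hfx f _

theorem signAvg_symTensorPow_le_of_type [CompleteSpace E] {p q : ℝ} (hp : 1 ≤ p) (hpq : p ≤ q)
    (hE : HasRademacherType.{u, w} E p) (hk : 1 ≤ k) {n : ℕ} (x : Fin n → E) :
    signAvg n (fun e => ‖∑ j, e j • symTensorPow k (x j)‖ ^ q) ≤
      (2 * k * kahaneKhintchineConst.{u, w} q p * typeConst.{u, w} E p) ^ q *
        (∑ j, (‖x j‖ ^ k) ^ p) ^ (q / p) := by
  have hK := kahaneKhintchineConst_nonneg.{u, w} q p
  have hτ := typeConst_nonneg.{u, w} E p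
  refine (signAvg_symTensorPow_le (hp.trans hpq) hk x).trans ?_
  rw [mul_assoc (2 * (k : ℝ)), Real.mul_rpow (x := 2 * (k : ℝ)) (by positivity)
    (mul_nonneg hK hτ), mul_assoc]
  refine mul_le_mul_of_nonneg_left ?_ (by positivity)
  refine (signAvg_rpow_le_of_type.{u, w} hp hpq hE _).trans (le_of_eq ?_)
  congr 2
  refine Finset.sum_congr rfl fun j _ => ?_
  -- The vectors fed to the type inequality have norm `‖x j‖ ^ (k - 1) * ‖x j‖ = ‖x j‖ ^ k`.
  rw [norm_smul, norm_pow, norm_norm, ← pow_succ, Nat.sub_add_cancel hk]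

end TensorPower

/-! ### Random variables -/

/-- `E` need not be separable, so strong measurability of the identity under the law has to be
inherited from `ξ`. It allows the moment bound to be proved on a power of `E` itself. -/
theorem aestronglyMeasurable_id_map {Ω E : Type*} [MeasurableSpace Ω] {P : Measure Ω}
    [TopologicalSpace E] [TopologicalSpace.PseudoMetrizableSpace E] [MeasurableSpace E]
    [BorelSpace E] {ξ : Ω → E} (hξ : AEStronglyMeasurable ξ P) :
    AEStronglyMeasurable (fun x : E => x) (P.map ξ) := by
  have h : IdentDistrib ξ (fun x : E => x) P (P.map ξ) :=
    ⟨hξ.aemeasurable, aemeasurable_id, by simp⟩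
  exact h.aestronglyMeasurable_snd hξ

section Moments

variable {k : ℕ} {E : Type u} [NormedAddCommGroup E]
  {X : Type*} [MeasurableSpace X] {μ : Measure X}

theorem eLpNorm_le_pow_of_norm_le {F : Type*} [NormedAddCommGroup F] (hk : 1 ≤ k) {q : ℝ}
    {ξ : X → E} {Y : X → F} (h : ∀ x, ‖Y x‖ ≤ ‖ξ x‖ ^ k) :
    eLpNorm Y (ENNReal.ofReal q) μ ≤ eLpNorm ξ (ENNReal.ofReal (k * q)) μ ^ k := by
  have h1 : eLpNorm Y (ENNReal.ofReal q) μ ≤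
      eLpNorm (fun x => ‖ξ x‖ ^ (k : ℝ)) (ENNReal.ofReal q) μ :=
    eLpNorm_mono_real fun x => by simpa using h x
  rw [eLpNorm_norm_rpow _ (by positivity), ← ENNReal.ofReal_mul' (by positivity), mul_comm q,
    ENNReal.rpow_natCast] at h1
  exact h1

theorem memLp_of_norm_le_pow {F : Type*} [NormedAddCommGroup F] (hk : 1 ≤ k) {q : ℝ}
    {ξ : X → E} (hξ : MemLp ξ (ENNReal.ofReal (k * q)) μ) {g : E → F} (hg : Continuous g)
    (h : ∀ x, ‖g x‖ ≤ ‖x‖ ^ k) : MemLp (fun x => g (ξ x)) (ENNReal.ofReal q) μ :=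
  ⟨hg.comp_aestronglyMeasurable hξ.1, (eLpNorm_le_pow_of_norm_le hk fun x => h (ξ x)).trans_lt
    (ENNReal.pow_lt_top hξ.2)⟩

end Moments

/-- The moment bound on the product space of `n` independent copies. -/
theorem lintegral_pi_error_le {E : Type u} [NormedAddCommGroup E] [NormedSpace ℝ E]
    [CompleteSpace E] [MeasurableSpace E] [BorelSpace E] {μ : Measure E} [IsProbabilityMeasure μ]
    {p q : ℝ} (hp : 1 ≤ p) (hpq : p ≤ q) (hE : HasRademacherType.{u, w} E p) {k n : ℕ}
    (hk : 1 ≤ k) (hn : 0 < n) (hμ : MemLp (fun x : E => x) (ENNReal.ofReal (k * q)) μ) :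
    ∫⁻ x : Fin n → E, ‖∑ j, (∫ y, symTensorPow k y ∂μ - symTensorPow k (x j))‖ₑ ^ q
        ∂(Measure.pi fun _ => μ) ≤
      (ENNReal.ofReal (2 * (2 * k * kahaneKhintchineConst.{u, w} q p * typeConst.{u, w} E p) *
        (n : ℝ) ^ (1 / p)) * eLpNorm (fun x : E => x) (ENNReal.ofReal (k * q)) μ ^ k) ^ q := by
  have hp0 : 0 < p := by linarith
  have hq0 : 0 < q := by linarith
  have hq1 : 1 ≤ q := hp.trans hpq
  set ν : Measure (Fin n → E) := Measure.pi fun _ => μ with hν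
  have hK := kahaneKhintchineConst_nonneg.{u, w} q p
  have hτ := typeConst_nonneg.{u, w} E p
  set D : ℝ := 2 * k * kahaneKhintchineConst.{u, w} q p * typeConst.{u, w} E p with hD
  have hD0 : 0 ≤ D := by positivity
  have hY : Integrable (symTensorPow k : E → SymInjTensor k E) μ :=
    (memLp_of_norm_le_pow hk hμ continuous_symTensorPow norm_symTensorPow_le).integrable
      (by simpa using hq1)
  set A := ∫⁻ x : E, ‖x‖ₑ ^ (k * q) ∂μ with hA
  have hqp : 1 ≤ q / p := (one_le_div hp0).2 hpq
  -- Since `q / p ≥ 1`, the power mean inequality gives `(∑ a_j ^ p) ^ (q / p) ≤ n ^ (q / p - 1) ∑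
  -- a_j ^ q` with `a_j = ‖x j‖ ^ k`. Integrating the last sum contributes the missing factor `n`.
  have hpt : ∀ x : Fin n → E,
      ENNReal.ofReal (signAvg n fun e => ‖∑ j, e j • symTensorPow k (x j)‖ ^ q) ≤
        ENNReal.ofReal (D ^ q) * ((n : ℝ≥0∞) ^ (q / p - 1) * ∑ j, ‖x j‖ₑ ^ (k * q)) := by
    intro x
    refine (ENNReal.ofReal_le_ofReal
      (signAvg_symTensorPow_le_of_type.{u, w} hp hpq hE hk x)).trans ?_
    rw [ENNReal.ofReal_mul (by positivity)]
    refine mul_le_mul_right ?_ _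
    rw [← ENNReal.ofReal_rpow_of_nonneg (by positivity) (by positivity),
      ENNReal.ofReal_sum_of_nonneg fun _ _ => by positivity]
    have h := ENNReal.rpow_sum_le_const_mul_sum_rpow (Finset.univ : Finset (Fin n))
      (fun j => ENNReal.ofReal ((‖x j‖ ^ k) ^ p)) hqp
    refine h.trans (le_of_eq ?_)
    rw [Finset.card_univ, Fintype.card_fin]
    congr 1
    refine Finset.sum_congr rfl fun j _ => ?_
    rw [← ENNReal.ofReal_rpow_of_nonneg (by positivity) hp0.le, ← ENNReal.rpow_mul,
      mul_div_cancel₀ q hp0.ne', ENNReal.ofReal_pow (norm_nonneg _), ofReal_norm,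
      ← ENNReal.rpow_natCast, ← ENNReal.rpow_mul]
  have hsum : ∫⁻ x : Fin n → E, ∑ j, ‖x j‖ₑ ^ (k * q) ∂ν = n * A := by
    have hm : AEMeasurable (fun x : E => ‖x‖ₑ ^ (k * q)) μ := hμ.1.enorm.pow_const _
    have hev : ∀ j : Fin n, MeasurePreserving (fun x : Fin n → E => x j) ν μ :=
      fun j => measurePreserving_eval (fun _ => μ) j
    rw [lintegral_finsetSum' (f := fun j (x : Fin n → E) => ‖x j‖ₑ ^ (k * q)) _ fun j _ =>
      hm.comp_quasiMeasurePreserving (hev j).quasiMeasurePreserving]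
    have hj : ∀ j : Fin n, ∫⁻ x, ‖x j‖ₑ ^ (k * q) ∂ν = A := fun j => by
      rw [hA, ← (hev j).map_eq, lintegral_map' (by rwa [(hev j).map_eq])
        (hev j).measurable.aemeasurable]
    simp [hj]
  refine (lintegral_symmetrization hq1 hY).trans ?_
  refine (mul_le_mul_right (lintegral_mono hpt) _).trans (le_of_eq ?_)
  have hn0 : (n : ℝ≥0∞) ≠ 0 := by exact_mod_cast hn.ne'
  have hntop : (n : ℝ≥0∞) ≠ ∞ := ENNReal.natCast_ne_top n
  have hnorm : (eLpNorm (fun x : E => x) (ENNReal.ofReal (k * q)) μ ^ k) ^ q = A := by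
    have hkq : 0 < k * q := by positivity
    rw [eLpNorm_eq_lintegral_rpow_enorm_toReal (ENNReal.ofReal_pos.2 hkq).ne'
        ENNReal.ofReal_ne_top,
      ENNReal.toReal_ofReal hkq.le, ← ENNReal.rpow_natCast, ← ENNReal.rpow_mul, ← ENNReal.rpow_mul,
      one_div_mul_cancel hkq.ne', ENNReal.rpow_one]
  rw [lintegral_const_mul' _ _ ENNReal.ofReal_ne_top,
    lintegral_const_mul' _ _ (ENNReal.rpow_ne_top_of_nonneg (by linarith) hntop), hsum,
    ENNReal.mul_rpow_of_nonneg _ _ hq0.le, hnorm, ENNReal.ofReal_rpow_of_nonneg (by positivity)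
    hq0.le, Real.mul_rpow (x := 2 * D) (by positivity) (by positivity),
    Real.mul_rpow zero_le_two hD0,
    ← Real.rpow_mul (by positivity), one_div_mul_eq_div, ENNReal.ofReal_mul (by positivity),
    ENNReal.ofReal_mul (by positivity), ← ENNReal.ofReal_rpow_of_nonneg zero_le_two hq0.le,
    ← ENNReal.ofReal_rpow_of_nonneg (Nat.cast_nonneg n) (by positivity), ENNReal.ofReal_natCast,
    ENNReal.ofReal_ofNat]
  have hpow : (n : ℝ≥0∞) ^ (q / p - 1) * n = (n : ℝ≥0∞) ^ (q / p) := by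
    nth_rewrite 2 [← ENNReal.rpow_one (n : ℝ≥0∞)]
    rw [← ENNReal.rpow_add _ _ hn0 hntop, sub_add_cancel]
  rw [← hpow]
  ring

end MonteCarloMoments

/-! ### The Monte Carlo error bound -/

theorem mainTheorem1 {E : Type u} [NormedAddCommGroup E] [NormedSpace ℝ E] [CompleteSpace E]
    [MeasurableSpace E] [BorelSpace E]
    {Ω : Type v} [MeasurableSpace Ω] (P : Measure Ω) [IsProbabilityMeasure P]
    (p q : ℝ) (hp1 : 1 ≤ p) (hp2 : p ≤ 2) (hpq : p ≤ q)
    (hE : HasRademacherType.{u, w} E p)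
    (k M : ℕ) (hk : 1 ≤ k) (hM : 0 < M)
    (ξ : Fin M → Ω → E)
    (hξ : ∀ j, MemLp (ξ j) (ENNReal.ofReal (k * q)) P)
    (hindep : iIndepFun ξ P)
    (hident : ∀ i j, IdentDistrib (ξ i) (ξ j) P P) :
    Integrable (fun ω => tensorPow k (ξ ⟨0, hM⟩ ω)) P ∧
    injMoment k (ξ ⟨0, hM⟩) P ∈ symPart k E ∧
    MemLp (fun ω => symProj k E (injMoment k (ξ ⟨0, hM⟩) P)
        - (M : ℝ)⁻¹ • ∑ j, symTensorPow k (ξ j ω)) (ENNReal.ofReal q) P ∧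
    eLpNorm (fun ω => symProj k E (injMoment k (ξ ⟨0, hM⟩) P)
        - (M : ℝ)⁻¹ • ∑ j, symTensorPow k (ξ j ω)) (ENNReal.ofReal q) P
      ≤ ENNReal.ofReal
          (2 * (2 * k * kahaneKhintchineConst.{u, w} q p * typeConst.{u, w} E p
            + khintchineConst.{w} q) * (M : ℝ) ^ (-(1 - 1 / p)))
        * eLpNorm (ξ ⟨0, hM⟩) (ENNReal.ofReal (k * q)) P ^ k := by
  have hq1 : 1 ≤ q := hp1.trans hpq
  have hq0 : 0 < q := by linarith
  have hM0 : (0 : ℝ) < M := by exact_mod_cast hM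
  have hint : Integrable (fun ω => tensorPow k (ξ ⟨0, hM⟩ ω)) P :=
    (memLp_of_norm_le_pow hk (hξ _) continuous_tensorPow norm_tensorPow_le).integrable
      (by simpa using hq1)
  have hY : ∀ j, MemLp (fun ω => symTensorPow k (ξ j ω)) (ENNReal.ofReal q) P := fun j =>
    memLp_of_norm_le_pow hk (hξ j) continuous_symTensorPow norm_symTensorPow_le
  refine ⟨hint, convex_symPart.integral_mem isClosed_closure
    (Filter.Eventually.of_forall fun ω => tensorPow_mem_symPart _) hint,
    (memLp_const _).sub ((memLp_finsetSum Finset.univ fun j _ => hY j).const_smul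
      (M : ℝ)⁻¹), ?_⟩
  set μ : Measure E := P.map (ξ ⟨0, hM⟩) with hμ
  have haem : ∀ j, AEMeasurable (ξ j) P := fun j => (hident j j).aemeasurable_fst
  have : IsProbabilityMeasure μ := Measure.isProbabilityMeasure_map (haem _)
  have hid : AEStronglyMeasurable (fun x : E => x) μ := aestronglyMeasurable_id_map (hξ _).1
  have hnormμ : eLpNorm (fun x : E => x) (ENNReal.ofReal (k * q)) μ =
      eLpNorm (ξ ⟨0, hM⟩) (ENNReal.ofReal (k * q)) P := eLpNorm_map_measure hid (haem _)
  have hμL : MemLp (fun x : E => x) (ENNReal.ofReal (k * q)) μ :=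
    ⟨hid, by rw [hnormμ]; exact (hξ _).2⟩
  have hYμ : AEStronglyMeasurable (symTensorPow k : E → SymInjTensor k E) μ :=
    continuous_symTensorPow.comp_aestronglyMeasurable hid
  -- A continuous linear map commutes with the Bochner integral, so the symmetrized moment is the
  -- mean of the symmetric tensor powers under the law of `ξ`.
  have hmean : symProj k E (injMoment k (ξ ⟨0, hM⟩) P) = ∫ y, symTensorPow k y ∂μ := by
    rw [injMoment, ← ContinuousLinearMap.integral_comp_comm _ hint, hμ,
      integral_map (haem _) hYμ]
    simp only [symProj_tensorPow]
  -- Independence and equality of laws make the joint law the product measure on which the moment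
  -- bound was proved.
  have hlaw : P.map (fun ω j => ξ j ω) = Measure.pi fun _ : Fin M => μ := by
    rw [(iIndepFun_iff_map_fun_eq_pi_map haem).1 hindep]
    congr 1
    funext j
    exact (hident j _).map_eq
  set m : SymInjTensor k E := ∫ y, symTensorPow k y ∂μ with hm
  -- The mean is distributed over the `M` summands, so that each of them is centred.
  have herr : ∀ ω, symProj k E (injMoment k (ξ ⟨0, hM⟩) P) -
      (M : ℝ)⁻¹ • ∑ j, symTensorPow k (ξ j ω) =
      (M : ℝ)⁻¹ • ∑ j, (m - symTensorPow k (ξ j ω)) := by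
    intro ω
    rw [hmean, Finset.sum_sub_distrib, smul_sub, Finset.sum_const, Finset.card_univ,
      Fintype.card_fin, ← Nat.cast_smul_eq_nsmul ℝ, smul_smul, inv_mul_cancel₀ hM0.ne', one_smul]
  simp only [herr]
  have hsmul : eLpNorm (fun ω => (M : ℝ)⁻¹ • ∑ j, (m - symTensorPow k (ξ j ω)))
      (ENNReal.ofReal q) P = ENNReal.ofReal (M : ℝ)⁻¹ *
        eLpNorm (fun ω => ∑ j, (m - symTensorPow k (ξ j ω))) (ENNReal.ofReal q) P := by
    have := eLpNorm_const_smul (M : ℝ)⁻¹ (fun ω => ∑ j, (m - symTensorPow k (ξ j ω)))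
      (ENNReal.ofReal q) P
    rw [Real.enorm_of_nonneg (by positivity)] at this
    exact this
  rw [hsmul]
  set D : ℝ := 2 * k * kahaneKhintchineConst.{u, w} q p * typeConst.{u, w} E p with hD
  have hD0 : 0 ≤ D := mul_nonneg (mul_nonneg (by positivity)
    (kahaneKhintchineConst_nonneg.{u, w} q p)) (typeConst_nonneg.{u, w} E p)
  have hsum : eLpNorm (fun ω => ∑ j, (m - symTensorPow k (ξ j ω))) (ENNReal.ofReal q) P ≤
      ENNReal.ofReal (2 * D * (M : ℝ) ^ (1 / p)) *
        eLpNorm (ξ ⟨0, hM⟩) (ENNReal.ofReal (k * q)) P ^ k := by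
    rw [eLpNorm_eq_lintegral_rpow_enorm_toReal (by simpa using hq0) ENNReal.ofReal_ne_top,
      ENNReal.toReal_ofReal hq0.le, one_div, ENNReal.rpow_inv_le_iff hq0, ← hnormμ]
    refine le_trans (le_of_eq ?_) (lintegral_pi_error_le.{u, w} hp1 hpq hE hk hM hμL)
    rw [← hlaw, lintegral_map' ?_ (aemeasurable_pi_lambda _ haem)]
    rw [hlaw]
    refine AEMeasurable.pow_const (AEStronglyMeasurable.enorm ?_) q
    refine Finset.aestronglyMeasurable_fun_sum _ fun j _ => aestronglyMeasurable_const.sub ?_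
    exact hYμ.comp_quasiMeasurePreserving
      (measurePreserving_eval (fun _ => μ) j).quasiMeasurePreserving
  refine (mul_le_mul_right hsum _).trans ?_
  rw [← mul_assoc, ← ENNReal.ofReal_mul (by positivity)]
  refine mul_le_mul_left (ENNReal.ofReal_le_ofReal ?_) _
  have hpow : (M : ℝ)⁻¹ * (M : ℝ) ^ (1 / p) = (M : ℝ) ^ (-(1 - 1 / p)) := by
    rw [← Real.rpow_neg_one, ← Real.rpow_add hM0]
    congr 1
    ring
  calc (M : ℝ)⁻¹ * (2 * D * (M : ℝ) ^ (1 / p)) = 2 * D * (M : ℝ) ^ (-(1 - 1 / p)) := by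
        rw [← hpow]
        ring
    -- The bound already holds without `B_q`; adding this nonnegative constant gives the stated
    -- form.
    _ ≤ _ := by
        gcongr
        exact le_add_of_nonneg_right (khintchineConst_nonneg.{w} q)
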